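/- **Terms.** Consider terms $M ::= x \mid \lambda x.M \mid MM \mid M\oplus M$ up to $\alpha$-equivalence, over countably many variables. Values are the variables and the abstractions. Contexts $C$ have exactly one hole, anywhere in a term; weak contexts are $W ::= [\,] \mid W M \mid M W$. Let $\to_{\beta_v}$ (resp. $\to_{w\beta_v}$) be the closure under arbitrary contexts (resp. weak contexts) of the rule $(\lambda x.M)V\mapsto M\{V/x\}$, $V$ a value. **Multi-distributions.** A multi-distribution $\mathbf m=[p_iM_i]_{i\in I}$ is a finite multiset of pairs of a real $p_i\in(0,1]$ and a term $M_i$, with $\sum_i p_i\le 1$. Write $[M]$ for $[1M]$, $+$ for multiset sum and $q\cdot[p_iM_i]_i=[(qp_i)M_i]_i$. **Reductions from terms to multi-distributions.** Put $C[(\lambda x.M)V]\to[\,C[M\{V/x\}]\,]$ for every context $C$, and $W[M\oplus N]\to[\tfrac12 W[M],\tfrac12 W[N]]$ for every weak context $W$; $\to$ is the union of these two relations. Surface reduction $\to_s\,\subseteq\,\to$ is defined in the same way, but with both rules closed under weak contexts only. A term $M$ is normal if there is no $\mathbf m$ with $M\to\mathbf m$, and surface normal if there is no $\mathbf m$ with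 $M\to_s\mathbf m$. **Unbiased evaluation.** The relation $\to_{u\beta_v}$ on terms is defined inductively: if $M\to_{w\beta_v}M'$ then $M\to_{u\beta_v}M'$; if $M$ has no $\to_{w\beta_v}$-step, then $M\to_{u\beta_v}M'$ whenever $M'$ results from $M$ (of the form $\lambda x.P$, $PQ$ or $P\oplus Q$) by a $\to_{u\beta_v}$-step in one immediate subterm. Unbiased evaluation $\to_e\,\subseteq\,\to$ is: if $M$ is not surface normal, $M\to_e\mathbf m$ iff $M\to_s\mathbf m$; if $M$ is surface normal, $M\to_e\mathbf m$ iff $\mathbf m=[M']$ for some $M'$ with $M\to_{u\beta_v}M'$. Let $\to_{\neg e}\,=\,\to\setminus\to_e$. **Lifting.** A relation $\to_r$ from terms to multi-distributions is lifted to a relation $\Rightarrow_r$ on multi-distributions by the rules: $[M]\Rightarrow_r[M]$; $[M]\Rightarrow_r\mathbf m$ if $M\to_r\mathbf m$; $[p_iM_i]_{i\in I}\Rightarrow_r\sum_{i\in I}p_i\cdot\mathbf m_i$ if $[M_i]\Rightarrow_r\mathbf m_i$ for all $i\in I$. Let $\Rightarrow,\Rightarrow_e,\Rightarrow_{\neg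 e}$ be the liftings of $\to,\to_e,\to_{\neg e}$, and let $*$ denote the reflexive-transitive closure. **Observation.** For a multi-distribution $\mathbf m=[p_iM_i]_{i\in I}$, $\mathrm{obs}_N(\mathbf m)$ is the subdistribution $\mu$ on the set of normal terms given by $\mu(N)=\sum_{i:\,M_i=N}p_i$. **Proposition (Factorization and $\mathrm{obs}_N$-neutrality).** For all multi-distributions $\mathbf m,\mathbf n$: 1. if $\mathbf m\Rightarrow^*\mathbf n$, then there is a multi-distribution $\mathbf t$ with $\mathbf m\Rightarrow_e^*\mathbf t$ and $\mathbf t\Rightarrow_{\neg e}^*\mathbf n$; 2. if $\mathbf m\Rightarrow_{\neg e}\mathbf n$, then $\mathrm{obs}_N(\mathbf m)=\mathrm{obs}_N(\mathbf n)$. -/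

import Mathlib

namespace PLam

/-! ## Terms -/

/-- Terms of the probabilistic lambda-calculus, `M ::= x | λx.M | M M | M ⊕ M`, up to renaming of
bound variables: de Bruijn terms. An index that points beyond all enclosing binders is a free
variable, so there are countably many free variables. -/
inductive Term : Type
  | var : ℕ → Term
  | lam : Term → Term
  | app : Term → Term → Term
  | choice : Term → Term → Term

namespace Term

/-- A renaming of the indices, extended under one binder. -/
def upRen (ρ : ℕ → ℕ) : ℕ → ℕ
  | 0 => 0
  | k + 1 => ρ k + 1

/-- Renaming of the free variables. -/
def rename : (ℕ → ℕ) → Term → Term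
  | ρ, var k => var (ρ k)
  | ρ, lam M => lam (rename (upRen ρ) M)
  | ρ, app M N => app (rename ρ M) (rename ρ N)
  | ρ, choice M N => choice (rename ρ M) (rename ρ N)

/-- A simultaneous substitution, extended under one binder. -/
def up (σ : ℕ → Term) : ℕ → Term
  | 0 => var 0
  | k + 1 => rename Nat.succ (σ k)

/-- Capture-avoiding simultaneous substitution. -/
def subst : (ℕ → Term) → Term → Term
  | σ, var k => σ k
  | σ, lam M => lam (subst (up σ) M)
  | σ, app M N => app (subst σ M) (subst σ N)
  | σ, choice M N => choice (subst σ M) (subst σ N)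

/-- The substitution that replaces index `0` by `N` and lowers all the other indices by one. -/
def single (N : Term) : ℕ → Term
  | 0 => N
  | k + 1 => var k

/-- `inst M N` is `M{N/x}`, where `x` is the variable bound by the `λ` in `lam M`. -/
def inst (M N : Term) : Term := subst (single N) M

/-- Values are the variables and the abstractions. -/
inductive IsValue : Term → Prop
  | var (k : ℕ) : IsValue (var k)
  | lam (M : Term) : IsValue (lam M)

end Term

open Term

/-! ## Contexts -/

/-- Contexts with exactly one hole. -/
inductive Ctx : Type
  | hole : Ctx
  | appL : Ctx → Term → Ctx
  | appR : Term → Ctx → Ctx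
  | lam : Ctx → Ctx
  | choiceL : Ctx → Term → Ctx
  | choiceR : Term → Ctx → Ctx

/-- `C.fill N` is `C` with the hole replaced by `N`; free variables of `N` may be captured. -/
def Ctx.fill : Ctx → Term → Term
  | .hole, N => N
  | .appL C M, N => .app (C.fill N) M
  | .appR M C, N => .app M (C.fill N)
  | .lam C, N => .lam (C.fill N)
  | .choiceL C M, N => .choice (C.fill N) M
  | .choiceR M C, N => .choice M (C.fill N)

/-- Weak contexts `W ::= □ | W M | M W`: the hole is neither under a `λ` nor under a `⊕`. -/
inductive Ctx.IsWeak : Ctx → Prop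
  | hole : Ctx.IsWeak .hole
  | appL (C : Ctx) (M : Term) : Ctx.IsWeak C → Ctx.IsWeak (.appL C M)
  | appR (M : Term) (C : Ctx) : Ctx.IsWeak C → Ctx.IsWeak (.appR M C)

/-! ## Call-by-value reductions from terms to terms -/

/-- The rule `(λx.M) V ↦ M{V/x}` for `V` a value. -/
inductive RootBetaV : Term → Term → Prop
  | mk (M V : Term) : IsValue V → RootBetaV (.app (.lam M) V) (inst M V)

/-- The closure of the rule under arbitrary contexts. -/
def BetaV (M M' : Term) : Prop :=
  ∃ (C : Ctx) (R R' : Term), RootBetaV R R' ∧ M = C.fill R ∧ M' = C.fill R'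

/-- The closure of the rule under weak contexts (surface reduction of the call-by-value calculus,
in arbitrary order). -/
def WeakBetaV (M M' : Term) : Prop :=
  ∃ (C : Ctx) (R R' : Term), C.IsWeak ∧ RootBetaV R R' ∧ M = C.fill R ∧ M' = C.fill R'

/-- Unbiased iteration of weak reduction: fire weak redexes as long as there is one; on terms
without weak redexes, iterate in any immediate subterm. -/
inductive UnbiasedBetaV : Term → Term → Prop
  | weak {M M' : Term} : WeakBetaV M M' → UnbiasedBetaV M M'
  | lam {P P' : Term} : (¬ ∃ N, WeakBetaV (.lam P) N) →
      UnbiasedBetaV P P' → UnbiasedBetaV (.lam P) (.lam P')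
  | appL {P P' Q : Term} : (¬ ∃ N, WeakBetaV (.app P Q) N) →
      UnbiasedBetaV P P' → UnbiasedBetaV (.app P Q) (.app P' Q)
  | appR {P Q Q' : Term} : (¬ ∃ N, WeakBetaV (.app P Q) N) →
      UnbiasedBetaV Q Q' → UnbiasedBetaV (.app P Q) (.app P Q')
  | choiceL {P P' Q : Term} : (¬ ∃ N, WeakBetaV (.choice P Q) N) →
      UnbiasedBetaV P P' → UnbiasedBetaV (.choice P Q) (.choice P' Q)
  | choiceR {P Q Q' : Term} : (¬ ∃ N, WeakBetaV (.choice P Q) N) →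
      UnbiasedBetaV Q Q' → UnbiasedBetaV (.choice P Q) (.choice P Q')

/-! ## Multi-distributions -/

/-- A multi-distribution on terms: a finite multiset of pairs `p M` with `p ∈ (0,1]` whose
probabilities have sum at most `1`. -/
@[ext] structure MDist : Type where
  entries : Multiset (ℝ × Term)
  mem_Ioc : ∀ e ∈ entries, e.1 ∈ Set.Ioc (0 : ℝ) 1
  sum_le : (entries.map Prod.fst).sum ≤ 1

/-- The multi-distribution `[1 M]`. -/
def MDist.pure (M : Term) : MDist where
  entries := {((1 : ℝ), M)}
  mem_Ioc := by simp
  sum_le := by simp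

/-- The multi-distribution `[1/2 M, 1/2 N]`. -/
noncomputable def MDist.coin (M N : Term) : MDist where
  entries := {((1 / 2 : ℝ), M), ((1 / 2 : ℝ), N)}
  mem_Ioc := by
    intro e he
    simp only [Multiset.insert_eq_cons, Multiset.mem_cons, Multiset.mem_singleton] at he
    rcases he with rfl | rfl <;> norm_num
  sum_le := by
    simp only [Multiset.insert_eq_cons, Multiset.map_cons, Multiset.map_singleton,
      Multiset.sum_cons, Multiset.sum_singleton]
    norm_num

/-- The scalar product `q · [pᵢ Mᵢ] = [(q pᵢ) Mᵢ]` on the underlying multisets. -/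
noncomputable def scale (q : ℝ) (s : Multiset (ℝ × Term)) : Multiset (ℝ × Term) :=
  s.map fun e => (q * e.1, e.2)

/-- The lifting of a relation from terms to multi-distributions to a relation on
multi-distributions, by the rules: `[M] ⇒ [M]`; `[M] ⇒ m` if `M → m`; and
`[pᵢ Mᵢ | i ∈ I] ⇒ ∑ᵢ pᵢ · mᵢ` if `[Mᵢ] ⇒ mᵢ` for all `i ∈ I`. -/
inductive Lift (r : Term → MDist → Prop) : MDist → MDist → Prop
  | refl (M : Term) : Lift r (MDist.pure M) (MDist.pure M)
  | step {M : Term} {m : MDist} : r M m → Lift r (MDist.pure M) m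
  | sum {k : ℕ} (p : Fin k → ℝ) (M : Fin k → Term) (m : Fin k → MDist) (a b : MDist) :
      a.entries = (Finset.univ : Finset (Fin k)).val.map (fun i => (p i, M i)) →
      b.entries = ∑ i : Fin k, scale (p i) (m i).entries →
      (∀ i, Lift r (MDist.pure (M i)) (m i)) →
      Lift r a b

/-! ## The probabilistic call-by-value calculus -/

/-- `C[(λx.M) V] → [C[M{V/x}]]`, for an arbitrary context `C`. -/
def RedBeta (M : Term) (m : MDist) : Prop :=
  ∃ M', BetaV M M' ∧ m = MDist.pure M'

/-- `W[(λx.M) V] → [W[M{V/x}]]`, for a weak context `W`. -/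
def SRedBeta (M : Term) (m : MDist) : Prop :=
  ∃ M', WeakBetaV M M' ∧ m = MDist.pure M'

/-- `W[P ⊕ Q] → [1/2 W[P], 1/2 W[Q]]`, for a weak context `W`. -/
def RedChoice (M : Term) (m : MDist) : Prop :=
  ∃ (W : Ctx) (P Q : Term), W.IsWeak ∧ M = W.fill (.choice P Q) ∧
    m = MDist.coin (W.fill P) (W.fill Q)

/-- The reduction `→` of the calculus. -/
def Red (M : Term) (m : MDist) : Prop := RedBeta M m ∨ RedChoice M m

/-- Surface reduction. -/
def SRed (M : Term) (m : MDist) : Prop := SRedBeta M m ∨ RedChoice M m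

/-- Normal forms of `→`. -/
def IsNormal (M : Term) : Prop := ¬ ∃ m, Red M m

/-- Surface normal forms. -/
def IsSNormal (M : Term) : Prop := ¬ ∃ m, SRed M m

/-- Unbiased evaluation: surface steps on terms that are not surface normal; on surface normal
terms, the steps of the unbiased iteration of weak beta-v reduction. -/
inductive UEval : Term → MDist → Prop
  | surface {M : Term} {m : MDist} : ¬ IsSNormal M → SRed M m → UEval M m
  | iterate {M M' : Term} : IsSNormal M → UnbiasedBetaV M M' → UEval M (MDist.pure M')

/-- Steps of `→` that are not steps of unbiased evaluation (the relation `→` minus unbiased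
evaluation). -/
def NonUEval (M : Term) (m : MDist) : Prop := Red M m ∧ ¬ UEval M m

/-! ## The observation of normal forms -/

/-- Probability subdistributions on a (countable) type. -/
@[ext] structure SubDist (Ω : Type) : Type where
  toFun : Ω → ℝ
  mem_Icc : ∀ x, toFun x ∈ Set.Icc (0 : ℝ) 1
  summable : Summable toFun
  tsum_le : ∑' x, toFun x ≤ 1

open Classical in
/-- The total probability of the pairs of a multiset whose term is `N`. -/
noncomputable def mass (s : Multiset (ℝ × Term)) (N : Term) : ℝ :=
  (s.map fun e => if e.2 = N then e.1 else 0).sum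

theorem mass_nonneg (s : Multiset (ℝ × Term)) (hs : ∀ e ∈ s, (0 : ℝ) ≤ e.1) (N : Term) :
    0 ≤ mass s N := by
  classical
  unfold mass
  apply Multiset.sum_nonneg
  intro x hx
  obtain ⟨e, he, rfl⟩ := Multiset.mem_map.1 hx
  split_ifs
  · exact hs e he
  · exact le_rfl

theorem sum_mass_le (s : Multiset (ℝ × Term)) (hs : ∀ e ∈ s, (0 : ℝ) ≤ e.1)
    (P : Term → Prop) (t : Finset {M : Term // P M}) :
    ∑ N ∈ t, mass s N.1 ≤ (s.map Prod.fst).sum := by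
  classical
  induction s using Multiset.induction_on with
  | empty => simp [mass]
  | cons a s ih =>
    have h1 : ∀ N : {M : Term // P M},
        mass (a ::ₘ s) N.1 = (if a.2 = N.1 then a.1 else 0) + mass s N.1 := by
      intro N
      simp only [mass, Multiset.map_cons, Multiset.sum_cons]
    simp only [h1, Finset.sum_add_distrib, Multiset.map_cons, Multiset.sum_cons]
    have ha : (0 : ℝ) ≤ a.1 := hs a (Multiset.mem_cons_self a s)
    have h2 := ih (fun e he => hs e (Multiset.mem_cons_of_mem he))
    have h3 : ∑ N ∈ t, (if a.2 = N.1 then a.1 else 0) ≤ a.1 := by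
      by_cases h : P a.2
      · have h4 : ∀ N : {M : Term // P M},
            (if a.2 = N.1 then a.1 else 0) = if (⟨a.2, h⟩ : {M : Term // P M}) = N then a.1 else 0 := by
          intro N
          simp [Subtype.ext_iff]
        simp only [h4, Finset.sum_ite_eq]
        split_ifs
        · exact le_rfl
        · exact ha
      · have h4 : ∀ N ∈ t, (if a.2 = N.1 then a.1 else 0) = 0 := by
          intro N _
          rw [if_neg]
          intro hN
          exact h (hN ▸ N.2)
        rw [Finset.sum_eq_zero h4]
        exact ha
    exact add_le_add h3 h2

/-- The observation `obsN`: the subdistribution over normal forms that assigns to a normal form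
`N` the sum of the probabilities `pᵢ` with `Mᵢ = N`. -/
noncomputable def obsN (m : MDist) : SubDist {N : Term // IsNormal N} :=
  have h0 : ∀ e ∈ m.entries, (0 : ℝ) ≤ e.1 := fun e he => (m.mem_Ioc e he).1.le
  have hb : ∀ t : Finset {N : Term // IsNormal N}, ∑ N ∈ t, mass m.entries N.1 ≤ 1 :=
    fun t => (sum_mass_le m.entries h0 IsNormal t).trans m.sum_le
  { toFun := fun N => mass m.entries N.1
    mem_Icc := fun N => ⟨mass_nonneg _ h0 _, by simpa using hb {N}⟩
    summable := summable_of_sum_le (fun N => mass_nonneg _ h0 _) hb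
    tsum_le := Real.tsum_le_of_sum_le (fun N => mass_nonneg _ h0 _) hb }

end PLam

/-!
Every beta reduction can be made standard (`exists_std`): weak steps first, then standard reductions
of the parts under the outermost `λ`s and `⊕`s. As a `⊕` in a weak position is not created by steps
under a `λ` or a `⊕`, surface steps can be brought forward over the other beta steps
(`LiftM.postpone`). This reduces the factorization of multi-distributions to that of the beta
reduction of each entry (`uEval_factorization`).

The delicate point is that non-evaluation steps are defined as a difference of relations on terms:
contracting a redex under a `λ` does not count as a non-evaluation step if some weak redex happens
to give the same result, as in `(λx.(λy.Q) x) V` with `x` not free in `Q`. Such a coincidence may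
occur in the middle of the inner part of a standard reduction. Unless the step leaves the term
unchanged, it is only possible if the inner redex is in the body `P` of a weak redex `(λx.P) V` with
`P{V/x} = (λx.P') V`, where `P → P'` by the inner redex. Then the weak redex can be contracted before the steps in its body, which leads to the same term and
leaves a standard reduction with fewer steps (`exists_avoiding_or_fires`). So the number of steps is
a measure that allows all the coincidences to be removed (`Std.weak_factorization`). If no weak
redex is left, then the same applies to the immediate subterms, which gives the factorization for
unbiased iteration (`unbiased_factorization`).

Neutrality of the observation holds since a non-evaluation step has neither a normal source nor a
normal target: it leaves some redex that evaluation would have to contract first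
(`NonUEval.exists_eq_pure`).
-/

namespace PLam

open Term Relation

/-! ### Substitution -/

namespace Term

theorem upRen_comp (ρ ξ : ℕ → ℕ) : (fun k => upRen ρ (upRen ξ k)) = upRen fun k => ρ (ξ k) := by
  funext k; cases k <;> rfl

theorem rename_rename (ρ ξ : ℕ → ℕ) (M : Term) :
    rename ρ (rename ξ M) = rename (fun k => ρ (ξ k)) M := by
  induction M generalizing ρ ξ with
  | var k => rfl
  | lam M ih => simp only [rename, ih, upRen_comp]
  | app M N ihM ihN => simp only [rename, ihM, ihN]
  | choice M N ihM ihN => simp only [rename, ihM, ihN]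

theorem up_comp_upRen (σ : ℕ → Term) (ρ : ℕ → ℕ) :
    (fun k => up σ (upRen ρ k)) = up fun k => σ (ρ k) := by
  funext k; cases k <;> rfl

theorem subst_rename (σ : ℕ → Term) (ρ : ℕ → ℕ) (M : Term) :
    subst σ (rename ρ M) = subst (fun k => σ (ρ k)) M := by
  induction M generalizing σ ρ with
  | var k => rfl
  | lam M ih => simp only [rename, subst, ih, up_comp_upRen]
  | app M N ihM ihN => simp only [rename, subst, ihM, ihN]
  | choice M N ihM ihN => simp only [rename, subst, ihM, ihN]

theorem rename_comp_up (ρ : ℕ → ℕ) (σ : ℕ → Term) :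
    (fun k => rename (upRen ρ) (up σ k)) = up fun k => rename ρ (σ k) := by
  funext k
  cases k with
  | zero => rfl
  | succ k => simp only [up, rename_rename]; rfl

theorem rename_subst (ρ : ℕ → ℕ) (σ : ℕ → Term) (M : Term) :
    rename ρ (subst σ M) = subst (fun k => rename ρ (σ k)) M := by
  induction M generalizing σ ρ with
  | var k => rfl
  | lam M ih => simp only [rename, subst, ih, rename_comp_up]
  | app M N ihM ihN => simp only [rename, subst, ihM, ihN]
  | choice M N ihM ihN => simp only [rename, subst, ihM, ihN]

theorem subst_comp_up (σ τ : ℕ → Term) :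
    (fun k => subst (up σ) (up τ k)) = up fun k => subst σ (τ k) := by
  funext k
  cases k with
  | zero => rfl
  | succ k => simp only [up, subst_rename, rename_subst]

theorem subst_subst (σ τ : ℕ → Term) (M : Term) :
    subst σ (subst τ M) = subst (fun k => subst σ (τ k)) M := by
  induction M generalizing σ τ with
  | var k => rfl
  | lam M ih => simp only [subst, ih, subst_comp_up]
  | app M N ihM ihN => simp only [subst, ihM, ihN]
  | choice M N ihM ihN => simp only [subst, ihM, ihN]

theorem up_var : up var = var := by
  funext k; cases k <;> rfl

theorem subst_var (M : Term) : subst var M = M := by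
  induction M with
  | var k => rfl
  | lam M ih => simp only [subst, up_var, ih]
  | app M N ihM ihN => simp only [subst, ihM, ihN]
  | choice M N ihM ihN => simp only [subst, ihM, ihN]

theorem up_var_comp (ρ : ℕ → ℕ) : up (fun k => var (ρ k)) = fun k => var (upRen ρ k) := by
  funext k; cases k <;> rfl

theorem rename_eq_subst (ρ : ℕ → ℕ) (M : Term) : rename ρ M = subst (fun k => var (ρ k)) M := by
  induction M generalizing ρ with
  | var k => rfl
  | lam M ih => simp only [rename, subst, ih, up_var_comp]
  | app M N ihM ihN => simp only [rename, subst, ihM, ihN]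
  | choice M N ihM ihN => simp only [rename, subst, ihM, ihN]

theorem subst_inst (σ : ℕ → Term) (M V : Term) :
    subst σ (inst M V) = inst (subst (up σ) M) (subst σ V) := by
  unfold inst
  rw [subst_subst, subst_subst]
  congr 1
  funext k
  cases k with
  | zero => rfl
  | succ k => simp only [single, up, subst, subst_rename]; exact (subst_var _).symm

theorem IsValue.subst {V : Term} (hV : IsValue V) {σ : ℕ → Term} (hσ : ∀ k, IsValue (σ k)) :
    IsValue (V.subst σ) := by
  cases hV with
  | var k => exact hσ k
  | lam M => exact .lam _

theorem isValue_up {σ : ℕ → Term} (hσ : ∀ k, IsValue (σ k)) (k : ℕ) : IsValue (up σ k) := by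
  cases k with
  | zero => exact .var 0
  | succ k =>
    simp only [up, rename_eq_subst]
    exact (hσ k).subst fun _ => .var _

theorem isValue_single {V : Term} (hV : IsValue V) (k : ℕ) : IsValue (single V k) := by
  cases k with
  | zero => exact hV
  | succ k => exact .var k

theorem isValue_up_iterate {σ : ℕ → Term} (hσ : ∀ k, IsValue (σ k)) (n : ℕ) :
    ∀ k, IsValue (up^[n] σ k) := by
  induction n with
  | zero => exact hσ
  | succ n ih => rw [Function.iterate_succ_apply']; exact isValue_up ih

end Term

/-! ### Weak, inner and arbitrary beta steps -/

/-- Contraction of a by-value beta redex in any position, by induction on the position. -/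
inductive BetaStep : Term → Term → Prop
  | root {M V : Term} : IsValue V → BetaStep (.app (.lam M) V) (inst M V)
  | lam {M M' : Term} : BetaStep M M' → BetaStep (.lam M) (.lam M')
  | appL {M M' N : Term} : BetaStep M M' → BetaStep (.app M N) (.app M' N)
  | appR {M N N' : Term} : BetaStep N N' → BetaStep (.app M N) (.app M N')
  | choiceL {M M' N : Term} : BetaStep M M' → BetaStep (.choice M N) (.choice M' N)
  | choiceR {M N N' : Term} : BetaStep N N' → BetaStep (.choice M N) (.choice M N')

/-- Contraction of a by-value beta redex in a weak position. -/
inductive WeakStep : Term → Term → Prop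
  | root {M V : Term} : IsValue V → WeakStep (.app (.lam M) V) (inst M V)
  | appL {M M' N : Term} : WeakStep M M' → WeakStep (.app M N) (.app M' N)
  | appR {M N N' : Term} : WeakStep N N' → WeakStep (.app M N) (.app M N')

/-- Contraction of a by-value beta redex that lies under some `λ` or `⊕`. A pair of terms may be
related by `WeakStep` and by `InnerStep`, through different redexes. -/
inductive InnerStep : Term → Term → Prop
  | lam {M M' : Term} : BetaStep M M' → InnerStep (.lam M) (.lam M')
  | appL {M M' N : Term} : InnerStep M M' → InnerStep (.app M N) (.app M' N)
  | appR {M N N' : Term} : InnerStep N N' → InnerStep (.app M N) (.app M N')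
  | choiceL {M M' N : Term} : BetaStep M M' → InnerStep (.choice M N) (.choice M' N)
  | choiceR {M N N' : Term} : BetaStep N N' → InnerStep (.choice M N) (.choice M N')

theorem betaV_iff {M M' : Term} : BetaV M M' ↔ BetaStep M M' := by
  constructor
  · rintro ⟨C, R, R', ⟨P, V, hV⟩, rfl, rfl⟩
    induction C with
    | hole => exact .root hV
    | appL C M ih => exact .appL ih
    | appR M C ih => exact .appR ih
    | lam C ih => exact .lam ih
    | choiceL C M ih => exact .choiceL ih
    | choiceR M C ih => exact .choiceR ih
  · intro h
    induction h with
    | root hV => exact ⟨.hole, _, _, ⟨_, _, hV⟩, rfl, rfl⟩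
    | lam _ ih => obtain ⟨C, R, R', hR, rfl, rfl⟩ := ih; exact ⟨.lam C, R, R', hR, rfl, rfl⟩
    | appL _ ih => obtain ⟨C, R, R', hR, rfl, rfl⟩ := ih; exact ⟨.appL C _, R, R', hR, rfl, rfl⟩
    | appR _ ih => obtain ⟨C, R, R', hR, rfl, rfl⟩ := ih; exact ⟨.appR _ C, R, R', hR, rfl, rfl⟩
    | choiceL _ ih =>
      obtain ⟨C, R, R', hR, rfl, rfl⟩ := ih; exact ⟨.choiceL C _, R, R', hR, rfl, rfl⟩
    | choiceR _ ih =>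
      obtain ⟨C, R, R', hR, rfl, rfl⟩ := ih; exact ⟨.choiceR _ C, R, R', hR, rfl, rfl⟩

theorem weakBetaV_iff {M M' : Term} : WeakBetaV M M' ↔ WeakStep M M' := by
  constructor
  · rintro ⟨C, R, R', hC, ⟨P, V, hV⟩, rfl, rfl⟩
    induction hC with
    | hole => exact .root hV
    | appL C M _ ih => exact .appL ih
    | appR M C _ ih => exact .appR ih
  · intro h
    induction h with
    | root hV => exact ⟨.hole, _, _, .hole, ⟨_, _, hV⟩, rfl, rfl⟩
    | appL _ ih =>
      obtain ⟨C, R, R', hC, hR, rfl, rfl⟩ := ih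
      exact ⟨.appL C _, R, R', .appL _ _ hC, hR, rfl, rfl⟩
    | appR _ ih =>
      obtain ⟨C, R, R', hC, hR, rfl, rfl⟩ := ih
      exact ⟨.appR _ C, R, R', .appR _ _ hC, hR, rfl, rfl⟩

theorem WeakStep.beta {M M' : Term} (h : WeakStep M M') : BetaStep M M' := by
  induction h with
  | root hV => exact .root hV
  | appL _ ih => exact .appL ih
  | appR _ ih => exact .appR ih

theorem InnerStep.beta {M M' : Term} (h : InnerStep M M') : BetaStep M M' := by
  induction h with
  | lam h => exact .lam h
  | appL _ ih => exact .appL ih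
  | appR _ ih => exact .appR ih
  | choiceL h => exact .choiceL h
  | choiceR h => exact .choiceR h

theorem BetaStep.weak_or_inner {M M' : Term} (h : BetaStep M M') :
    WeakStep M M' ∨ InnerStep M M' := by
  induction h with
  | root hV => exact .inl (.root hV)
  | lam h => exact .inr (.lam h)
  | appL _ ih => exact ih.imp .appL .appL
  | appR _ ih => exact ih.imp .appR .appR
  | choiceL h => exact .inr (.choiceL h)
  | choiceR h => exact .inr (.choiceR h)

theorem WeakStep.subst {M M' : Term} (h : WeakStep M M') {σ : ℕ → Term}
    (hσ : ∀ k, IsValue (σ k)) : WeakStep (M.subst σ) (M'.subst σ) := by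
  induction h with
  | root hV => rw [subst_inst]; exact .root (hV.subst hσ)
  | appL _ ih => exact .appL ih
  | appR _ ih => exact .appR ih

theorem Term.IsValue.not_weakStep {V : Term} (hV : IsValue V) {M : Term} : ¬ WeakStep V M := by
  intro h; cases hV <;> cases h

theorem WeakStep.eq_inst {P V N : Term} (hV : IsValue V) (h : WeakStep (.app (.lam P) V) N) :
    N = inst P V := by
  cases h with
  | root _ => rfl
  | appL h => cases h
  | appR h => exact absurd h hV.not_weakStep

/-- The term is an abstraction. -/
def IsLam (M : Term) : Prop := ∃ P, M = .lam P

theorem InnerStep.isLam_iff {M M' : Term} (h : InnerStep M M') : IsLam M ↔ IsLam M' := by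
  cases h <;> simp [IsLam]

theorem InnerStep.isValue_iff {M M' : Term} (h : InnerStep M M') : IsValue M ↔ IsValue M' := by
  cases h <;> constructor <;> intro h <;> first | exact .lam _ | cases h

/-- Inner steps neither create nor destroy weak redexes. -/
theorem InnerStep.weak_reducible_iff {M M' : Term} (h : InnerStep M M') :
    (∃ N, WeakStep M N) ↔ ∃ N, WeakStep M' N := by
  induction h with
  | lam _ => constructor <;> rintro ⟨_, ⟨⟩⟩
  | choiceL _ => constructor <;> rintro ⟨_, ⟨⟩⟩
  | choiceR _ => constructor <;> rintro ⟨_, ⟨⟩⟩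
  | appL h ih =>
    constructor
    · rintro ⟨_, h'⟩
      cases h' with
      | root hV => cases h with | lam _ => exact ⟨_, .root hV⟩
      | appL h' => obtain ⟨_, h''⟩ := ih.1 ⟨_, h'⟩; exact ⟨_, .appL h''⟩
      | appR h' => exact ⟨_, .appR h'⟩
    · rintro ⟨_, h'⟩
      cases h' with
      | root hV => cases h with | lam _ => exact ⟨_, .root hV⟩
      | appL h' => obtain ⟨_, h''⟩ := ih.2 ⟨_, h'⟩; exact ⟨_, .appL h''⟩
      | appR h' => exact ⟨_, .appR h'⟩
  | appR h ih =>
    constructor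
    · rintro ⟨_, h'⟩
      cases h' with
      | root hV => exact ⟨_, .root (h.isValue_iff.1 hV)⟩
      | appL h' => exact ⟨_, .appL h'⟩
      | appR h' => obtain ⟨_, h''⟩ := ih.1 ⟨_, h'⟩; exact ⟨_, .appR h''⟩
    · rintro ⟨_, h'⟩
      cases h' with
      | root hV => exact ⟨_, .root (h.isValue_iff.2 hV)⟩
      | appL h' => exact ⟨_, .appL h'⟩
      | appR h' => obtain ⟨_, h''⟩ := ih.2 ⟨_, h'⟩; exact ⟨_, .appR h''⟩

/-! ### Standard reductions -/

/-- Standard reductions with their number of steps. `Std true M N n`: weak steps lead from `M` to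
some `T` with `Std false T N`. `Std false T N n`: `N` results from `T` by standard reductions of the
parts of `T` under its outermost `λ`s and `⊕`s, so `T` and `N` have the same applicative shape. -/
inductive Std : Bool → Term → Term → ℕ → Prop
  | head {M M' N : Term} {n : ℕ} : WeakStep M M' → Std true M' N n → Std true M N (n + 1)
  | inner {M N : Term} {n : ℕ} : Std false M N n → Std true M N n
  | var (k : ℕ) : Std false (.var k) (.var k) 0
  | lam {P P' : Term} {n : ℕ} : Std true P P' n → Std false (.lam P) (.lam P') n
  | app {A A' B B' : Term} {n m : ℕ} : Std false A A' n → Std false B B' m →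
      Std false (.app A B) (.app A' B') (n + m)
  | choice {A A' B B' : Term} {n m : ℕ} : Std true A A' n → Std true B B' m →
      Std false (.choice A B) (.choice A' B') (n + m)

theorem Std.refl_inner (M : Term) : Std false M M 0 := by
  induction M with
  | var k => exact .var k
  | lam M ih => exact .lam (.inner ih)
  | app M N ihM ihN => exact .app ihM ihN
  | choice M N ihM ihN => exact .choice (.inner ihM) (.inner ihN)

theorem Std.refl (b : Bool) (M : Term) : Std b M M 0 := by
  cases b
  · exact .refl_inner M
  · exact .inner (.refl_inner M)

theorem Std.toTrue {b : Bool} {M N : Term} {n : ℕ} (h : Std b M N n) : Std true M N n := by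
  cases b
  · exact .inner h
  · exact h

theorem Std.head_star {M M' N : Term} {n : ℕ} (h : ReflTransGen WeakStep M M')
    (h' : Std true M' N n) : ∃ n', Std true M N n' := by
  induction h using ReflTransGen.head_induction_on with
  | refl => exact ⟨n, h'⟩
  | head h _ ih => obtain ⟨k, hk⟩ := ih; exact ⟨_, .head h hk⟩

theorem Std.decompose {M N : Term} {n : ℕ} (h : Std true M N n) :
    ∃ T, ∃ m ≤ n, ReflTransGen WeakStep M T ∧ Std false T N m := by
  generalize hb : true = b at h
  induction h with
  | head hw _ ih =>
    obtain ⟨T, m, hm, hT, hN⟩ := ih hb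
    exact ⟨T, m, by omega, .head hw hT, hN⟩
  | inner h => exact ⟨_, _, le_rfl, .refl, h⟩
  | _ => cases hb

theorem Std.app_true {A A' B B' : Term} {n m : ℕ} (hA : Std true A A' n) (hB : Std true B B' m) :
    Std true (.app A B) (.app A' B') (n + m) := by
  generalize hb : true = b at hA
  induction hA with
  | head hw _ ih =>
    have := ih hb
    rw [Nat.add_right_comm]
    exact .head (.appL hw) this
  | @inner A A' n h ih =>
    clear ih
    generalize hb' : true = b' at hB
    induction hB with
    | head hw _ ih => exact .head (.appR hw) (ih hb')
    | inner h' => exact .inner (.app h h')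
    | _ => cases hb'
  | _ => cases hb

theorem Std.beta_star {b : Bool} {M N : Term} {n : ℕ} (h : Std b M N n) :
    ReflTransGen BetaStep M N ∧ (b = false → ReflTransGen InnerStep M N) := by
  induction h with
  | head hw _ ih => exact ⟨.head hw.beta ih.1, nofun⟩
  | inner _ ih => exact ⟨ih.1, nofun⟩
  | var k => exact ⟨.refl, fun _ => .refl⟩
  | lam _ ih =>
    have := ih.1.lift Term.lam fun _ _ => InnerStep.lam
    exact ⟨ReflTransGen.mono (fun _ _ => InnerStep.beta) _ _ this, fun _ => this⟩
  | app _ _ ihA ihB =>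
    have := ((ihA.2 rfl).lift (Term.app · _) fun _ _ => InnerStep.appL).trans
      ((ihB.2 rfl).lift (Term.app _ ·) fun _ _ => InnerStep.appR)
    exact ⟨ReflTransGen.mono (fun _ _ => InnerStep.beta) _ _ this, fun _ => this⟩
  | choice _ _ ihA ihB =>
    have := (ihA.1.lift (Term.choice · _) fun _ _ => InnerStep.choiceL).trans
      (ihB.1.lift (Term.choice _ ·) fun _ _ => InnerStep.choiceR)
    exact ⟨ReflTransGen.mono (fun _ _ => InnerStep.beta) _ _ this, fun _ => this⟩

/-- Substituting the same values on both sides preserves the number of steps. -/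
theorem Std.subst_values {b : Bool} {M N : Term} {n : ℕ} (h : Std b M N n) {σ : ℕ → Term}
    (hσ : ∀ k, IsValue (σ k)) : Std b (M.subst σ) (N.subst σ) n := by
  induction h generalizing σ with
  | head hw _ ih => exact .head (hw.subst hσ) (ih hσ)
  | inner _ ih => exact .inner (ih hσ)
  | var k => exact .refl _ _
  | lam _ ih => exact .lam (ih (isValue_up hσ))
  | app _ _ ihA ihB => exact .app (ihA hσ) (ihB hσ)
  | choice _ _ ihA ihB => exact .choice (ihA hσ) (ihB hσ)

theorem Std.isValue_iff {M N : Term} {n : ℕ} (h : Std false M N n) : IsValue M ↔ IsValue N := by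
  cases h <;> constructor <;> intro h <;> first | exact .lam _ | exact .var _ | cases h

theorem Std.isLam_iff {M N : Term} {n : ℕ} (h : Std false M N n) : IsLam M ↔ IsLam N := by
  cases h <;> simp [IsLam]

theorem Std.up {σ τ : ℕ → Term} (h : ∀ k, ∃ n, Std false (σ k) (τ k) n) (k : ℕ) :
    ∃ n, Std false (up σ k) (up τ k) n := by
  cases k with
  | zero => exact ⟨0, .refl _ _⟩
  | succ k =>
    obtain ⟨n, hn⟩ := h k
    simp only [Term.up, rename_eq_subst]
    exact ⟨n, hn.subst_values fun _ => .var _⟩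

theorem Std.subst {b : Bool} {M N : Term} {n : ℕ} (h : Std b M N n) {σ τ : ℕ → Term}
    (hσ : ∀ k, IsValue (σ k)) (hστ : ∀ k, ∃ n, Std false (σ k) (τ k) n) :
    ∃ m, Std b (M.subst σ) (N.subst τ) m := by
  induction h generalizing σ τ with
  | head hw _ ih => obtain ⟨m, hm⟩ := ih hσ hστ; exact ⟨_, .head (hw.subst hσ) hm⟩
  | inner _ ih => obtain ⟨m, hm⟩ := ih hσ hστ; exact ⟨_, .inner hm⟩
  | var k => exact hστ k
  | lam _ ih => obtain ⟨m, hm⟩ := ih (isValue_up hσ) (Std.up hστ); exact ⟨_, .lam hm⟩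
  | app _ _ ihA ihB =>
    obtain ⟨m, hm⟩ := ihA hσ hστ
    obtain ⟨k, hk⟩ := ihB hσ hστ
    exact ⟨_, .app hm hk⟩
  | choice _ _ ihA ihB =>
    obtain ⟨m, hm⟩ := ihA hσ hστ
    obtain ⟨k, hk⟩ := ihB hσ hστ
    exact ⟨_, .choice hm hk⟩

/-- A standard reduction followed by a beta step can be rearranged into a standard reduction. -/
theorem Std.step {M N N' : Term} {n : ℕ} (h : Std true M N n) (h' : BetaStep N N') :
    ∃ m, Std true M N' m := by
  obtain ⟨T, m, -, hT, hN⟩ := h.decompose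
  suffices ∃ m, Std true T N' m by
    obtain ⟨m, hm⟩ := this
    exact hm.head_star hT
  clear h hT
  induction h' generalizing T m with
  | @root P V hV =>
    cases hN with
    | app hA hB =>
      cases hA with
      | lam hP =>
        have hV' := hB.isValue_iff.2 hV
        obtain ⟨k, hk⟩ := hP.subst (isValue_single hV') (τ := single V) fun i => by
          cases i with
          | zero => exact ⟨_, hB⟩
          | succ i => exact ⟨_, .var i⟩
        exact ⟨_, .head (.root hV') hk⟩
  | lam _ ih =>
    cases hN with
    | lam hP =>
      obtain ⟨T', m', -, hT', hP'⟩ := hP.decompose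
      obtain ⟨k, hk⟩ := ih _ _ hP'
      obtain ⟨l, hl⟩ := hk.head_star hT'
      exact ⟨_, .inner (.lam hl)⟩
  | appL _ ih =>
    cases hN with
    | app hA hB => obtain ⟨k, hk⟩ := ih _ _ hA; exact ⟨_, hk.app_true hB.toTrue⟩
  | appR _ ih =>
    cases hN with
    | app hA hB => obtain ⟨k, hk⟩ := ih _ _ hB; exact ⟨_, hA.toTrue.app_true hk⟩
  | choiceL _ ih =>
    cases hN with
    | choice hA hB =>
      obtain ⟨T', m', -, hT', hA'⟩ := hA.decompose
      obtain ⟨k, hk⟩ := ih _ _ hA'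
      obtain ⟨l, hl⟩ := hk.head_star hT'
      exact ⟨_, .inner (.choice hl hB)⟩
  | choiceR _ ih =>
    cases hN with
    | choice hA hB =>
      obtain ⟨T', m', -, hT', hB'⟩ := hB.decompose
      obtain ⟨k, hk⟩ := ih _ _ hB'
      obtain ⟨l, hl⟩ := hk.head_star hT'
      exact ⟨_, .inner (.choice hA hl)⟩

/-- Standardization for by-value beta reduction. -/
theorem exists_std {M N : Term} (h : ReflTransGen BetaStep M N) : ∃ n, Std true M N n := by
  induction h with
  | refl => exact ⟨0, .refl _ _⟩
  | tail _ h ih => obtain ⟨n, hn⟩ := ih; exact hn.step h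

/-! ### Self-reproducing substitution instances -/

/-- Above `k > 0` binders the substituted value is renamed away from the index `k` that it replaces,
so the body of the value cannot have `var k` as its head. -/
theorem eq_zero_of_up_iterate_single_eq {V : Term} {k i : ℕ} {X : Term}
    (h : up^[k] (single V) i = .lam (.app (.var i) X)) : k = 0 ∧ i = 0 := by
  induction k generalizing i X with
  | zero =>
    cases i with
    | zero => exact ⟨rfl, rfl⟩
    | succ i => cases h
  | succ k ih =>
    rw [Function.iterate_succ_apply'] at h
    cases i with
    | zero => cases h
    | succ j =>
      rw [Term.up] at h
      -- The renaming sends `var l` under the `λ` to `var (j + 1)` only if `l = j` and `0 < j`.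
      generalize hs : up^[k] (single V) j = s at h
      cases s with
      | lam s =>
        cases s with
        | app s t =>
          cases s with
          | var l =>
            simp only [rename, lam.injEq, app.injEq, var.injEq] at h
            cases l with
            | zero => simp [upRen] at h
            | succ l =>
              have : j = l + 1 := by simpa [upRen] using h.1.symm
              subst this
              have := ih hs
              omega
          | _ => simp [rename] at h
        | _ => simp [rename] at h
      | _ => simp [rename] at h

/-- The equation recurs, under one more binder, for a proper subterm of `T`. -/
theorem subst_ne_app_lam_self {V : Term} (hV : IsValue V) : ∀ (T B : Term) (k : ℕ),
    T.subst (up^[k + 1] (single V)) ≠ .app (.lam T) B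
  | .var i, B, k, h => by
    have : IsValue (.app (.lam (.var i)) B) := h ▸ isValue_up_iterate (isValue_single hV) (k + 1) i
    nomatch this
  | .lam _, B, k, h => by cases h
  | .choice _ _, B, k, h => by cases h
  | .app (.var i) B₁, B, k, h => by
    rw [Term.subst, app.injEq] at h
    exact absurd (eq_zero_of_up_iterate_single_eq h.1).1 (by omega)
  | .app (.lam T₂) B₁, B, k, h => by
    rw [Term.subst, app.injEq, Term.subst, lam.injEq, ← Function.iterate_succ_apply' up] at h
    exact subst_ne_app_lam_self hV T₂ B₁ (k + 1) h.1
  | .app (.app _ _) B₁, B, k, h => by cases h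
  | .app (.choice _ _) B₁, B, k, h => by cases h

/-- The equation would make `E` an infinite tower of abstractions, as it recurs for a proper subterm
of `E`. -/
theorem BetaStep.subst_ne_head_lam {τ : ℕ → Term} : ∀ {E E' : Term}, BetaStep E E' →
    E.subst (up τ) ≠ .app (.var 0) (.lam E')
  | .app E₁ E₂, E', hE, h => by
    rw [Term.subst, app.injEq] at h
    obtain ⟨h₁, h₂⟩ := h
    have h₁' : E₁ = .var 0 := by
      cases E₁ with
      | var i =>
        cases i with
        | zero => rfl
        | succ i =>
          simp only [Term.subst, Term.up] at h₁
          cases hs : τ i <;> simp [hs, rename] at h₁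
      | _ => cases h₁
    subst h₁'
    cases hE with
    | appL h => cases h
    | appR hE₂ =>
      cases hE₂ with
      | lam hE₃ =>
        rw [Term.subst, lam.injEq] at h₂
        exact hE₃.subst_ne_head_lam h₂
      | _ => cases h₂
  | .var _, _, hE, _ => by cases hE
  | .lam _, _, _, h => by cases h
  | .choice _ _, _, _, h => by cases h

theorem BetaStep.subst_ne_lam_app {τ : ℕ → Term} {D D' : Term} (hD : BetaStep D D') :
    D.subst τ ≠ .lam (.app (.var 0) D') := by
  intro h
  cases hD with
  | lam hE =>
    rw [Term.subst, lam.injEq] at h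
    exact hE.subst_ne_head_lam h
  | _ => cases h

/-- No beta step in the argument of an application `A D` is a coincidence in the sense of
`exists_avoiding_or_fires`. -/
theorem BetaStep.subst_app_ne {V A D D' B : Term} (hV : IsValue V) (hD : BetaStep D D') {k : ℕ}
    (hB : k = 0 → B = V) :
    (Term.app A D).subst (up^[k] (single V)) ≠ .app (.lam (.app A D')) B := by
  intro h
  rw [Term.subst, app.injEq] at h
  obtain ⟨hA, hD'⟩ := h
  cases A with
  | var i =>
    obtain ⟨rfl, rfl⟩ := eq_zero_of_up_iterate_single_eq hA
    rw [hB rfl] at hD'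
    exact hD.subst_ne_lam_app (hD'.trans hA)
  | lam R =>
    rw [Term.subst, lam.injEq, ← Function.iterate_succ_apply' up] at hA
    exact subst_ne_app_lam_self hV _ _ k hA
  | _ => cases hA

/-- Reducing the argument of a redex never has the same effect as contracting the redex. -/
theorem BetaStep.inst_ne {P V V' : Term} (hV : IsValue V) (h : BetaStep V V') :
    inst P V ≠ .app (.lam P) V' := by
  intro hP
  cases P with
  | app A B =>
    rw [inst, Term.subst, app.injEq] at hP
    obtain ⟨hA, hB⟩ := hP
    cases A with
    | var i =>
      obtain ⟨-, rfl⟩ := eq_zero_of_up_iterate_single_eq (k := 0) hA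
      rw [Term.subst, single] at hA
      subst hA
      cases h with
      | lam h =>
        cases h with
        | appL h => cases h
        | appR h => exact h.subst_ne_lam_app hB
    | lam R =>
      rw [Term.subst, lam.injEq] at hA
      exact subst_ne_app_lam_self hV _ _ 0 hA
    | _ => cases hA
  | var i =>
    have : IsValue (.app (.lam (.var i)) V') := hP ▸ isValue_single hV i
    nomatch this
  | _ => cases hP

/-! ### Avoiding coincidences of inner and weak steps -/

/-- A beta step from `X` to `Y` such that the instance `X.subst σ` is not the application `(λY) B`.
If `σ` substitutes `B` for the index `0`, this says that the redex `(λX) B` does not contract to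
`(λY) B`, the effect of the step on `(λX) B`. -/
def AvoidingStep (σ : ℕ → Term) (B X Y : Term) : Prop :=
  BetaStep X Y ∧ X.subst σ ≠ .app (.lam Y) B

/-- The instance `X.subst σ` has a standard reduction to `(λY) B'` that is shorter than `n` steps,
the length of one from `X` to `Y`, together with any standard reduction from `B` to `B'`. -/
def Fires (σ : ℕ → Term) (B X Y : Term) (n : ℕ) : Prop :=
  ∀ B' m, Std true B B' m → ∃ l < n + m, Std true (X.subst σ) (.app (.lam Y) B') l

/-- The weak redex `(λM) B`, with `M` reducing to `N`, either allows all the steps from `M` to `N`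
to be taken under its `λ` without any of them having the effect of contracting the redex, or it can
be contracted at once, leaving a shorter standard reduction. This is the case `k = 0`, where `B` is
the substituted value `V`; the induction enters the bodies of abstractions, and there `k` counts
the binders passed, and `B` is the argument of the abstraction whose body is being reduced. The
second part is the first one for the body of an abstraction, in a form that the induction can use.

If a weak step `X → Y` is a coincidence, then the steps from `M` to `X` are weak as well and remain
so after the substitution, which turns `X` into `(λY) B`: the step `X → Y` is saved. If an inner
step in `X = (λR) D` is a coincidence, then so is its counterpart in `R`, for the argument `D`. -/
theorem exists_avoiding_or_fires {V : Term} (hV : IsValue V) {b : Bool} {M N : Term} {n : ℕ}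
    (h : Std b M N n) :
    (∀ k B, (k = 0 → B = V) → ReflTransGen (AvoidingStep (up^[k] (single V)) B) M N ∨
      Fires (up^[k] (single V)) B M N n) ∧
    (∀ P Q, b = false → M = .lam P → N = .lam Q → ∀ k B, (k = 0 → B = V) →
      ReflTransGen (AvoidingStep (up^[k] (single V)) B) P Q ∨
      Fires (up^[k] (single V)) B P Q n) := by
  induction h with
  | @head M M' N n hw hN ih =>
    refine ⟨fun k B hB => ?_, nofun⟩
    rcases ih.1 k B hB with h | h
    · by_cases hM : M.subst (up^[k] (single V)) = .app (.lam M') B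
      · refine .inr fun B' m hm => ⟨n + m, by omega, ?_⟩
        rw [hM]
        exact (Std.inner (.lam hN)).app_true hm
      · exact .inl (.head ⟨hw.beta, hM⟩ h)
    · refine .inr fun B' m hm => ?_
      obtain ⟨l, hl, hl'⟩ := h B' m hm
      exact ⟨l + 1, by omega, .head (hw.subst (isValue_up_iterate (isValue_single hV) k)) hl'⟩
  | inner _ ih => exact ⟨ih.1, nofun⟩
  | var i => exact ⟨fun k B hB => .inl .refl, nofun⟩
  | @lam P P' n hP ih =>
    refine ⟨fun k B hB => .inl ?_, ?_⟩
    · exact hP.beta_star.1.lift Term.lam fun _ _ h => ⟨.lam h, nofun⟩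
    · rintro P Q - ⟨⟩ ⟨⟩
      exact ih.1
  | choice hA hD =>
    refine ⟨fun k B hB => .inl ?_, nofun⟩
    exact (hA.beta_star.1.lift (Term.choice · _) fun _ _ h => ⟨.choiceL h, nofun⟩).trans
      (hD.beta_star.1.lift (Term.choice _ ·) fun _ _ h => ⟨.choiceR h, nofun⟩)
  | @app A A' D D' n m hA hD ihA ihD =>
    refine ⟨fun k B hB => ?_, nofun⟩
    -- The steps in `A` come first, so that `D` is still available as the argument of `(λY) D`.
    have tail : ReflTransGen (AvoidingStep (up^[k] (single V)) B) (.app A' D) (.app A' D') :=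
      hD.beta_star.1.lift (Term.app A' ·) fun _ _ h => ⟨.appR h, h.subst_app_ne hV hB⟩
    suffices ReflTransGen (AvoidingStep (up^[k] (single V)) B) (.app A D) (.app A' D) ∨
        Fires (up^[k] (single V)) B (.app A D) (.app A' D') (n + m) from
      this.imp (fun h => h.trans tail) id
    by_cases hAv : IsValue A
    · cases hA with
      | var i => exact .inl .refl
      | @lam R R' n hR =>
        by_cases hDB : D.subst (up^[k] (single V)) = B
        · rcases ihA.2 R R' rfl rfl rfl (k + 1) D (by omega) with h | h
          · refine .inl (h.lift (fun X => Term.app (.lam X) D) fun X Y h' => ?_)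
            refine ⟨.appL (.lam h'.1), fun h'' => h'.2 ?_⟩
            rw [Term.subst, app.injEq, Term.subst, lam.injEq] at h''
            rw [Function.iterate_succ_apply']
            exact h''.1
          · refine .inr fun B' l hl => ?_
            obtain ⟨j, hj, hj'⟩ := h _ _ hD.toTrue
            refine ⟨j + l, by omega, ?_⟩
            rw [Term.subst, hDB, Term.subst, ← Function.iterate_succ_apply' up]
            exact (Std.inner (.lam hj')).app_true hl
        · refine .inl (hR.beta_star.1.lift (fun X => Term.app (.lam X) D) fun X Y h' => ?_)
          refine ⟨.appL (.lam h'), fun h'' => hDB ?_⟩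
          rw [Term.subst, app.injEq] at h''
          exact h''.2
      | _ => cases hAv
    · left
      have hs := hA.beta_star.2 rfl
      clear hA ihA tail
      induction hs using ReflTransGen.head_induction_on with
      | refl => exact .refl
      | @head X Y h h' ih =>
        refine .head ⟨.appL h.beta, fun h'' => ?_⟩ (ih (h.isValue_iff.not.1 hAv))
        rw [Term.subst, app.injEq] at h''
        cases X with
        | var i => exact hAv (.var i)
        | lam P => exact hAv (.lam P)
        | _ => cases h''.1

/-! ### Factorization of beta reduction with respect to weak and unbiased reduction -/

/-- A beta step that is not a weak step; the excluded coincidences are those with a weak step on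
another redex. -/
def NonWeakStep (M N : Term) : Prop := BetaStep M N ∧ ¬ WeakStep M N

theorem NonWeakStep.inner {M N : Term} (h : NonWeakStep M N) : InnerStep M N :=
  h.1.weak_or_inner.resolve_left h.2

theorem NonWeakStep.isLam_iff {M N : Term} (h : ReflTransGen NonWeakStep M N) :
    IsLam M ↔ IsLam N := by
  induction h with
  | refl => rfl
  | tail _ h ih => exact ih.trans h.inner.isLam_iff

theorem NonWeakStep.isValue_iff {M N : Term} (h : ReflTransGen NonWeakStep M N) :
    IsValue M ↔ IsValue N := by
  induction h with
  | refl => rfl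
  | tail _ h ih => exact ih.trans h.inner.isValue_iff

theorem WeakStep.app_inv {A B N : Term} (h : WeakStep (.app A B) N)
    (hAB : ¬ (IsLam A ∧ IsValue B)) :
    (∃ A', WeakStep A A' ∧ N = .app A' B) ∨ ∃ B', WeakStep B B' ∧ N = .app A B' := by
  cases h with
  | root hV => exact absurd ⟨⟨_, rfl⟩, hV⟩ hAB
  | appL h => exact .inl ⟨_, h, rfl⟩
  | appR h => exact .inr ⟨_, h, rfl⟩

theorem NonWeakStep.star_appL {A A' B : Term} (h : ReflTransGen NonWeakStep A A')
    (hAB : ¬ (IsLam A' ∧ IsValue B)) : ReflTransGen NonWeakStep (.app A B) (.app A' B) := by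
  induction h using ReflTransGen.head_induction_on with
  | refl => exact .refl
  | @head X Y h h' ih =>
    by_cases hXY : X = Y
    · rw [hXY]; exact ih
    refine .head ⟨.appL h.1, fun hw => ?_⟩ ih
    rcases hw.app_inv (by rwa [NonWeakStep.isLam_iff (.head h h')]) with ⟨Z, hZ, e⟩ | ⟨Z, hZ, e⟩
    · cases e; exact h.2 hZ
    · cases e; exact hXY rfl

theorem NonWeakStep.star_appR {A B B' : Term} (h : ReflTransGen NonWeakStep B B')
    (hAB : ¬ (IsLam A ∧ IsValue B')) : ReflTransGen NonWeakStep (.app A B) (.app A B') := by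
  induction h using ReflTransGen.head_induction_on with
  | refl => exact .refl
  | @head X Y h h' ih =>
    by_cases hXY : X = Y
    · rw [hXY]; exact ih
    refine .head ⟨.appR h.1, fun hw => ?_⟩ ih
    rcases hw.app_inv (by rwa [NonWeakStep.isValue_iff (.head h h')]) with ⟨Z, hZ, e⟩ | ⟨Z, hZ, e⟩
    · cases e; exact hXY rfl
    · cases e; exact h.2 hZ

/-- A beta reduction factorizes into weak steps followed by steps that are not weak steps. The
induction is on the number of steps of a standard reduction, which decreases whenever a redex has
to be contracted to avoid a coincidence, and then on the target term. -/
theorem Std.weak_factorization {M N : Term} {n : ℕ} (h : Std true M N n) :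
    ∃ T, ReflTransGen WeakStep M T ∧ ReflTransGen NonWeakStep T N := by
  induction n using Nat.strong_induction_on generalizing M N with
  | _ n IH =>
  suffices ∀ N, ∀ m ≤ n, ∀ M, Std true M N m →
      ∃ T, ReflTransGen WeakStep M T ∧ ReflTransGen NonWeakStep T N from this N n le_rfl M h
  clear h M N
  intro N
  induction N with
  | var k =>
    intro m _ M h
    obtain ⟨T, m', hm, hT, hN⟩ := h.decompose
    cases hN
    exact ⟨_, hT, .refl⟩
  | lam Q _ =>
    intro m _ M h
    obtain ⟨T, m', hm, hT, hN⟩ := h.decompose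
    cases hN with
    | lam hP => exact ⟨_, hT, hP.beta_star.1.lift Term.lam fun _ _ h => ⟨.lam h, nofun⟩⟩
  | choice A B _ _ =>
    intro m _ M h
    obtain ⟨T, m', hm, hT, hN⟩ := h.decompose
    cases hN with
    | choice hA hB =>
      exact ⟨_, hT,
        (hA.beta_star.1.lift (Term.choice · _) fun _ _ h => ⟨.choiceL h, nofun⟩).trans
          (hB.beta_star.1.lift (Term.choice _ ·) fun _ _ h => ⟨.choiceR h, nofun⟩)⟩
  | app A' B' ihA ihB =>
    intro m hmn M h
    obtain ⟨T, m', hm, hT, hN⟩ := h.decompose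
    suffices ∃ U, ReflTransGen WeakStep T U ∧ ReflTransGen NonWeakStep U (.app A' B') by
      obtain ⟨U, hU, hU'⟩ := this
      exact ⟨U, hT.trans hU, hU'⟩
    clear hT h
    cases hN with
    | @app A _ B _ a b hA hB =>
      by_cases hAB : IsLam A ∧ IsValue B
      · obtain ⟨⟨P, rfl⟩, hV⟩ := hAB
        cases hA with
        | @lam _ P' _ hP =>
          rcases (exists_avoiding_or_fires hV hP).1 0 B (fun _ => rfl) with h | h
          · refine ⟨_, .refl, .trans (b := .app (.lam P') B) ?_ ?_⟩
            · refine h.lift (fun X => Term.app (.lam X) B) fun X Y h => ?_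
              exact ⟨.appL (.lam h.1), fun hw => h.2 (hw.eq_inst hV).symm⟩
            · have hs := hB.beta_star.2 rfl
              clear ihA ihB IH hP hB h
              induction hs using ReflTransGen.head_induction_on with
              | refl => exact .refl
              | @head X Y h _ ih =>
                exact .head ⟨.appR h.beta, fun hw => h.beta.inst_ne hV (hw.eq_inst hV).symm⟩
                  (ih (h.isValue_iff.1 hV))
          · obtain ⟨l, hl, hl'⟩ := h B' b hB.toTrue
            obtain ⟨U, hU, hU'⟩ := IH l (by omega) hl'
            exact ⟨U, .head (.root hV) hU, hU'⟩
      · obtain ⟨A₁, hA₁, hA₂⟩ := ihA a (by omega) A hA.toTrue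
        obtain ⟨B₁, hB₁, hB₂⟩ := ihB b (by omega) B hB.toTrue
        have hAB' : ¬ (IsLam A' ∧ IsValue B') := by rwa [← hA.isLam_iff, ← hB.isValue_iff]
        refine ⟨.app A₁ B₁, (hA₁.lift (Term.app · B) fun _ _ => .appL).trans
          (hB₁.lift (Term.app A₁ ·) fun _ _ => .appR), ?_⟩
        refine (NonWeakStep.star_appL hA₂ ?_).trans (NonWeakStep.star_appR hB₂ hAB')
        rwa [NonWeakStep.isValue_iff hB₂]

/-- The term has a weak step. -/
def WeakReducible (M : Term) : Prop := ∃ N, WeakStep M N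

theorem exists_weakBetaV_iff {M : Term} : (∃ N, WeakBetaV M N) ↔ WeakReducible M := by
  simp only [weakBetaV_iff, WeakReducible]

theorem BetaStep.not_weakReducible {M N : Term} (h : BetaStep M N) (hM : ¬ WeakReducible M) :
    ¬ WeakReducible N := by
  rcases h.weak_or_inner with h | h
  · exact absurd ⟨_, h⟩ hM
  · exact h.weak_reducible_iff.not.1 hM

theorem UnbiasedBetaV.beta {M N : Term} (h : UnbiasedBetaV M N) : BetaStep M N := by
  induction h with
  | weak h => exact (weakBetaV_iff.1 h).beta
  | lam _ _ ih => exact .lam ih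
  | appL _ _ ih => exact .appL ih
  | appR _ _ ih => exact .appR ih
  | choiceL _ _ ih => exact .choiceL ih
  | choiceR _ _ ih => exact .choiceR ih

theorem UnbiasedBetaV.weakStep {M N : Term} (h : UnbiasedBetaV M N) (hM : WeakReducible M) :
    WeakStep M N := by
  rw [← exists_weakBetaV_iff] at hM
  cases h with
  | weak h => exact weakBetaV_iff.1 h
  | _ => contradiction

/-- A beta step that is not a step of unbiased iteration. -/
def NonUnbiasedStep (M N : Term) : Prop := BetaStep M N ∧ ¬ UnbiasedBetaV M N

/-- An elementary context, into which unbiased iteration descends if there is no weak redex. -/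
structure IsFrame (f : Term → Term) : Prop where
  beta : ∀ {X Y}, BetaStep X Y → BetaStep (f X) (f Y)
  unbiased : ∀ {X Y}, ¬ WeakReducible (f X) → UnbiasedBetaV X Y → UnbiasedBetaV (f X) (f Y)
  unbiased_inv : ∀ {X Y}, ¬ WeakReducible (f X) → UnbiasedBetaV (f X) (f Y) →
    X = Y ∨ UnbiasedBetaV X Y

theorem isFrame_lam : IsFrame Term.lam where
  beta := .lam
  unbiased h := .lam (exists_weakBetaV_iff.not.2 h)
  unbiased_inv h h' := by
    cases h' with
    | weak h' => exact absurd ⟨_, weakBetaV_iff.1 h'⟩ h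
    | lam _ h' => exact .inr h'

theorem isFrame_appL (B : Term) : IsFrame (Term.app · B) where
  beta := .appL
  unbiased h := .appL (exists_weakBetaV_iff.not.2 h)
  unbiased_inv h h' := by
    cases h' with
    | weak h' => exact absurd ⟨_, weakBetaV_iff.1 h'⟩ h
    | appL _ h' => exact .inr h'
    | appR _ h' => exact .inl rfl

theorem isFrame_appR (A : Term) : IsFrame (Term.app A ·) where
  beta := .appR
  unbiased h := .appR (exists_weakBetaV_iff.not.2 h)
  unbiased_inv h h' := by
    cases h' with
    | weak h' => exact absurd ⟨_, weakBetaV_iff.1 h'⟩ h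
    | appL _ h' => exact .inl rfl
    | appR _ h' => exact .inr h'

theorem isFrame_choiceL (B : Term) : IsFrame (Term.choice · B) where
  beta := .choiceL
  unbiased h := .choiceL (exists_weakBetaV_iff.not.2 h)
  unbiased_inv h h' := by
    cases h' with
    | weak h' => exact absurd ⟨_, weakBetaV_iff.1 h'⟩ h
    | choiceL _ h' => exact .inr h'
    | choiceR _ h' => exact .inl rfl

theorem isFrame_choiceR (A : Term) : IsFrame (Term.choice A ·) where
  beta := .choiceR
  unbiased h := .choiceR (exists_weakBetaV_iff.not.2 h)
  unbiased_inv h h' := by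
    cases h' with
    | weak h' => exact absurd ⟨_, weakBetaV_iff.1 h'⟩ h
    | choiceL _ h' => exact .inl rfl
    | choiceR _ h' => exact .inr h'

theorem IsFrame.unbiased_star {f : Term → Term} (hf : IsFrame f) {X Y : Term}
    (hX : ¬ WeakReducible (f X)) (h : ReflTransGen UnbiasedBetaV X Y) :
    ReflTransGen UnbiasedBetaV (f X) (f Y) ∧ ¬ WeakReducible (f Y) := by
  induction h with
  | refl => exact ⟨.refl, hX⟩
  | tail _ h ih => exact ⟨ih.1.tail (hf.unbiased ih.2 h), (hf.beta h.beta).not_weakReducible ih.2⟩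

theorem IsFrame.nonUnbiased_star {f : Term → Term} (hf : IsFrame f) {X Y : Term}
    (hX : ¬ WeakReducible (f X)) (h : ReflTransGen NonUnbiasedStep X Y) :
    ReflTransGen NonUnbiasedStep (f X) (f Y) ∧ ¬ WeakReducible (f Y) := by
  induction h with
  | refl => exact ⟨.refl, hX⟩
  | @tail Z W _ h ih =>
    refine ⟨?_, (hf.beta h.1).not_weakReducible ih.2⟩
    by_cases hZ : Z = W
    · exact hZ ▸ ih.1
    · exact ih.1.tail ⟨hf.beta h.1, fun h' => (hf.unbiased_inv ih.2 h').elim hZ h.2⟩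

theorem NonWeakStep.nonUnbiased_star {M N : Term} (hM : WeakReducible M)
    (h : ReflTransGen NonWeakStep M N) : ReflTransGen NonUnbiasedStep M N := by
  induction h using ReflTransGen.head_induction_on with
  | refl => exact .refl
  | head h _ ih =>
    exact .head ⟨h.1, fun h' => h.2 (h'.weakStep hM)⟩ (ih (h.inner.weak_reducible_iff.1 hM))

/-- Factorizations of both parts of a binary constructor combine, if there is no weak redex. -/
theorem unbiased_factorization_pair {g : Term → Term → Term} (hl : ∀ B, IsFrame (g · B))
    (hr : ∀ A, IsFrame (g A ·)) {A₀ A₁ A₂ B₀ B₁ B₂ : Term} (h : ¬ WeakReducible (g A₀ B₀))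
    (hA : ReflTransGen UnbiasedBetaV A₀ A₁) (hA' : ReflTransGen NonUnbiasedStep A₁ A₂)
    (hB : ReflTransGen UnbiasedBetaV B₀ B₁) (hB' : ReflTransGen NonUnbiasedStep B₁ B₂) :
    ∃ T, ReflTransGen UnbiasedBetaV (g A₀ B₀) T ∧
      ReflTransGen NonUnbiasedStep T (g A₂ B₂) := by
  obtain ⟨h₁, n₁⟩ := (hl _).unbiased_star h hA
  obtain ⟨h₂, n₂⟩ := (hr _).unbiased_star n₁ hB
  obtain ⟨h₃, n₃⟩ := (hl _).nonUnbiased_star n₂ hA'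
  exact ⟨_, h₁.trans h₂, h₃.trans ((hr _).nonUnbiased_star n₃ hB').1⟩

theorem exists_unbiased_star_std {M N : Term} (h : ReflTransGen BetaStep M N) :
    ∃ T, ReflTransGen UnbiasedBetaV M T ∧ (ReflTransGen NonUnbiasedStep T N ∨
      ¬ WeakReducible T ∧ ∃ n, Std false T N n) := by
  obtain ⟨n, hn⟩ := exists_std h
  obtain ⟨T, hT, hN⟩ := hn.weak_factorization
  refine ⟨T, ReflTransGen.mono (fun _ _ h => .weak (weakBetaV_iff.2 h)) _ _ hT, ?_⟩
  by_cases hred : WeakReducible T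
  · exact .inl (NonWeakStep.nonUnbiased_star hred hN)
  obtain ⟨k, hk⟩ := exists_std (ReflTransGen.mono (fun _ _ h => h.1) _ _ hN)
  obtain ⟨T₁, m, -, hT₁, hs⟩ := hk.decompose
  rcases hT₁.cases_head with rfl | ⟨_, h, _⟩
  · exact .inr ⟨hred, m, hs⟩
  · exact absurd ⟨_, h⟩ hred

/-- A beta reduction factorizes into steps of unbiased iteration followed by steps that are not
steps of unbiased iteration. -/
theorem unbiased_factorization {M N : Term} (h : ReflTransGen BetaStep M N) :
    ∃ T, ReflTransGen UnbiasedBetaV M T ∧ ReflTransGen NonUnbiasedStep T N := by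
  have lift : ∀ {N : Term}, (∀ T n, ¬ WeakReducible T → Std false T N n →
      ∃ U, ReflTransGen UnbiasedBetaV T U ∧ ReflTransGen NonUnbiasedStep U N) →
      ∀ {b M n}, Std b M N n →
        ∃ U, ReflTransGen UnbiasedBetaV M U ∧ ReflTransGen NonUnbiasedStep U N := by
    intro N ih b M n h
    obtain ⟨T, hT, hN | ⟨hred, n, hn⟩⟩ := exists_unbiased_star_std h.beta_star.1
    · exact ⟨T, hT, hN⟩
    · obtain ⟨U, hU, hU'⟩ := ih T n hred hn
      exact ⟨U, hT.trans hU, hU'⟩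
  obtain ⟨n, hn⟩ := exists_std h
  refine lift ?_ hn
  clear h hn n
  induction N with
  | var k =>
    intro T n _ h
    cases h
    exact ⟨_, .refl, .refl⟩
  | lam Q ih =>
    intro T n hred h
    cases h with
    | lam hP =>
      obtain ⟨U, hU, hU'⟩ := lift ih hP
      obtain ⟨h₁, n₁⟩ := isFrame_lam.unbiased_star hred hU
      exact ⟨_, h₁, (isFrame_lam.nonUnbiased_star n₁ hU').1⟩
  | app A B ihA ihB =>
    intro T n hred h
    cases h with
    | app hA hB =>
      obtain ⟨_, hA₁, hA₂⟩ := lift ihA hA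
      obtain ⟨_, hB₁, hB₂⟩ := lift ihB hB
      exact unbiased_factorization_pair isFrame_appL isFrame_appR hred hA₁ hA₂ hB₁ hB₂
  | choice A B ihA ihB =>
    intro T n hred h
    cases h with
    | choice hA hB =>
      obtain ⟨_, hA₁, hA₂⟩ := lift ihA hA
      obtain ⟨_, hB₁, hB₂⟩ := lift ihB hB
      exact unbiased_factorization_pair isFrame_choiceL isFrame_choiceR hred hA₁ hA₂ hB₁ hB₂

/-! ### Evaluation of single terms -/

/-- `ChoiceStep M M₁ M₂`: resolving a `⊕` in a weak position of `M` gives `M₁` or `M₂`. -/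
inductive ChoiceStep : Term → Term → Term → Prop
  | root (P Q : Term) : ChoiceStep (.choice P Q) P Q
  | appL {M M₁ M₂ N : Term} : ChoiceStep M M₁ M₂ → ChoiceStep (.app M N) (.app M₁ N) (.app M₂ N)
  | appR {M N N₁ N₂ : Term} : ChoiceStep N N₁ N₂ → ChoiceStep (.app M N) (.app M N₁) (.app M N₂)

theorem redChoice_iff {M : Term} {m : MDist} :
    RedChoice M m ↔ ∃ M₁ M₂, ChoiceStep M M₁ M₂ ∧ m = MDist.coin M₁ M₂ := by
  constructor
  · rintro ⟨W, P, Q, hW, rfl, rfl⟩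
    refine ⟨_, _, ?_, rfl⟩
    induction hW with
    | hole => exact .root P Q
    | appL C M _ ih => exact .appL ih
    | appR M C _ ih => exact .appR ih
  · rintro ⟨M₁, M₂, h, rfl⟩
    suffices ∃ (W : Ctx) (P Q : Term), W.IsWeak ∧ M = W.fill (.choice P Q) ∧
        M₁ = W.fill P ∧ M₂ = W.fill Q by
      obtain ⟨W, P, Q, hW, e, rfl, rfl⟩ := this
      exact ⟨W, P, Q, hW, e, rfl⟩
    induction h with
    | root P Q => exact ⟨.hole, P, Q, .hole, rfl, rfl, rfl⟩
    | appL _ ih =>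
      obtain ⟨W, P, Q, hW, rfl, rfl, rfl⟩ := ih
      exact ⟨.appL W _, P, Q, .appL _ _ hW, rfl, rfl, rfl⟩
    | appR _ ih =>
      obtain ⟨W, P, Q, hW, rfl, rfl, rfl⟩ := ih
      exact ⟨.appR _ W, P, Q, .appR _ _ hW, rfl, rfl, rfl⟩

/-- The term has a `⊕` in a weak position. -/
def ChoiceReducible (M : Term) : Prop := ∃ M₁ M₂, ChoiceStep M M₁ M₂

theorem choiceReducible_app {A B : Term} :
    ChoiceReducible (.app A B) ↔ ChoiceReducible A ∨ ChoiceReducible B := by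
  constructor
  · rintro ⟨_, _, h⟩
    cases h with
    | appL h => exact .inl ⟨_, _, h⟩
    | appR h => exact .inr ⟨_, _, h⟩
  · rintro (⟨_, _, h⟩ | ⟨_, _, h⟩)
    · exact ⟨_, _, .appL h⟩
    · exact ⟨_, _, .appR h⟩

theorem InnerStep.choiceReducible_iff {M N : Term} (h : InnerStep M N) :
    ChoiceReducible M ↔ ChoiceReducible N := by
  induction h with
  | lam _ => constructor <;> rintro ⟨_, _, ⟨⟩⟩
  | appL _ ih => simp only [choiceReducible_app, ih]
  | appR _ ih => simp only [choiceReducible_app, ih]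
  | choiceL _ => exact ⟨fun _ => ⟨_, _, .root _ _⟩, fun _ => ⟨_, _, .root _ _⟩⟩
  | choiceR _ => exact ⟨fun _ => ⟨_, _, .root _ _⟩, fun _ => ⟨_, _, .root _ _⟩⟩

theorem isSNormal_iff {M : Term} : IsSNormal M ↔ ¬ WeakReducible M ∧ ¬ ChoiceReducible M := by
  rw [IsSNormal, ← not_or, not_iff_not]
  constructor
  · rintro ⟨m, ⟨N, h, -⟩ | h⟩
    · exact .inl ⟨N, weakBetaV_iff.1 h⟩
    · obtain ⟨M₁, M₂, h, -⟩ := redChoice_iff.1 h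
      exact .inr ⟨M₁, M₂, h⟩
  · rintro (⟨N, h⟩ | ⟨M₁, M₂, h⟩)
    · exact ⟨_, .inl ⟨N, weakBetaV_iff.2 h, rfl⟩⟩
    · exact ⟨_, .inr (redChoice_iff.2 ⟨M₁, M₂, h, rfl⟩)⟩

theorem InnerStep.isSNormal_iff {M N : Term} (h : InnerStep M N) : IsSNormal M ↔ IsSNormal N := by
  rw [PLam.isSNormal_iff, PLam.isSNormal_iff, h.choiceReducible_iff]
  exact and_congr_left' (not_congr h.weak_reducible_iff)

theorem BetaStep.isSNormal {M N : Term} (h : BetaStep M N) (hM : IsSNormal M) : IsSNormal N := by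
  rcases h.weak_or_inner with h | h
  · exact absurd ⟨_, h⟩ (isSNormal_iff.1 hM).1
  · exact h.isSNormal_iff.1 hM

theorem MDist.pure_injective {M N : Term} (h : MDist.pure M = MDist.pure N) : M = N := by
  have := congrArg MDist.entries h
  simpa [MDist.pure] using this

theorem MDist.pure_ne_coin {M N₁ N₂ : Term} : MDist.pure M ≠ MDist.coin N₁ N₂ := by
  intro h
  have := congrArg (fun m => Multiset.card m.entries) h
  simp [MDist.pure, MDist.coin] at this

theorem SRed.uEval {M : Term} {m : MDist} (h : SRed M m) : UEval M m :=
  .surface (fun h' => h' ⟨m, h⟩) h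

theorem red_pure_iff {M N : Term} : Red M (MDist.pure N) ↔ BetaStep M N := by
  constructor
  · rintro (⟨N', h, e⟩ | h)
    · rw [MDist.pure_injective e]; exact betaV_iff.1 h
    · obtain ⟨_, _, -, e⟩ := redChoice_iff.1 h
      exact absurd e MDist.pure_ne_coin
  · exact fun h => .inl ⟨N, betaV_iff.2 h, rfl⟩

theorem uEval_pure_of_not_isSNormal {M N : Term} (hM : ¬ IsSNormal M) :
    UEval M (MDist.pure N) ↔ WeakStep M N := by
  constructor
  · intro h
    generalize hm : MDist.pure N = m at h
    cases h with
    | surface _ h =>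
      rcases h with ⟨N', h, rfl⟩ | h
      · rw [MDist.pure_injective hm]; exact weakBetaV_iff.1 h
      · obtain ⟨_, _, -, rfl⟩ := redChoice_iff.1 h
        exact absurd hm MDist.pure_ne_coin
    | iterate h => exact absurd h hM
  · exact fun h => .surface hM (.inl ⟨N, weakBetaV_iff.2 h, rfl⟩)

theorem uEval_pure_of_isSNormal {M N : Term} (hM : IsSNormal M) :
    UEval M (MDist.pure N) ↔ UnbiasedBetaV M N := by
  constructor
  · intro h
    generalize hm : MDist.pure N = m at h
    cases h with
    | surface h => exact absurd hM h
    | iterate _ h => rw [MDist.pure_injective hm]; exact h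
  · exact fun h => .iterate hM h

/-- A beta reduction between terms factorizes with respect to unbiased evaluation. -/
theorem uEval_factorization {M N : Term} (h : ReflTransGen BetaStep M N) :
    ∃ T, ReflTransGen (fun X Y => UEval X (MDist.pure Y)) M T ∧
      ReflTransGen (fun X Y => NonUEval X (MDist.pure Y)) T N := by
  obtain ⟨n, hn⟩ := exists_std h
  obtain ⟨T, hT, hN⟩ := hn.weak_factorization
  have hT' : ReflTransGen (fun X Y => UEval X (MDist.pure Y)) M T :=
    ReflTransGen.mono (fun X Y h => SRed.uEval (.inl ⟨Y, weakBetaV_iff.2 h, rfl⟩)) _ _ hT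
  by_cases hs : IsSNormal T
  · obtain ⟨U, hU, hU'⟩ := unbiased_factorization (ReflTransGen.mono (fun _ _ h => h.1) _ _ hN)
    have key : ReflTransGen (fun X Y => UEval X (MDist.pure Y)) T U ∧ IsSNormal U := by
      clear hU'
      induction hU with
      | refl => exact ⟨.refl, hs⟩
      | tail _ h ih => exact ⟨ih.1.tail (.iterate ih.2 h), h.beta.isSNormal ih.2⟩
    refine ⟨U, hT'.trans key.1, ?_⟩
    have hUs := key.2
    clear key hU
    induction hU' using ReflTransGen.head_induction_on with
    | refl => exact .refl
    | head h _ ih =>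
      exact .head ⟨red_pure_iff.2 h.1, (uEval_pure_of_isSNormal hUs).not.2 h.2⟩
        (ih (h.1.isSNormal hUs))
  · refine ⟨T, hT', ?_⟩
    clear hT hT'
    induction hN using ReflTransGen.head_induction_on with
    | refl => exact .refl
    | head h _ ih =>
      exact .head ⟨red_pure_iff.2 h.1, (uEval_pure_of_not_isSNormal hs).not.2 h.2⟩
        (ih (h.inner.isSNormal_iff.not.1 hs))

theorem IsFrame.reducible {f : Term → Term} (hf : IsFrame f) {X Y : Term} (h : BetaStep X Y)
    (ih : ¬ UnbiasedBetaV X Y → ∃ Z, BetaStep Y Z) (hu : ¬ UnbiasedBetaV (f X) (f Y)) :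
    ∃ Z, BetaStep (f Y) Z := by
  by_cases hX : WeakReducible (f X)
  · have hi := (hf.beta h).weak_or_inner.resolve_left fun h => hu (.weak (weakBetaV_iff.2 h))
    obtain ⟨Z, hZ⟩ := hi.weak_reducible_iff.1 hX
    exact ⟨Z, hZ.beta⟩
  · obtain ⟨Z, hZ⟩ := ih fun h => hu (hf.unbiased hX h)
    exact ⟨f Z, hf.beta hZ⟩

/-- A beta step that unbiased iteration does not take leaves a redex that unbiased iteration would
have to contract, so it does not lead to a normal form. -/
theorem BetaStep.reducible_of_not_unbiased {M N : Term} (h : BetaStep M N)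
    (hu : ¬ UnbiasedBetaV M N) : ∃ N', BetaStep N N' := by
  induction h with
  | root hV => exact absurd (.weak (weakBetaV_iff.2 (.root hV))) hu
  | lam h ih => exact isFrame_lam.reducible h ih hu
  | appL h ih => exact (isFrame_appL _).reducible h ih hu
  | appR h ih => exact (isFrame_appR _).reducible h ih hu
  | choiceL h ih => exact (isFrame_choiceL _).reducible h ih hu
  | choiceR h ih => exact (isFrame_choiceR _).reducible h ih hu

theorem NonUEval.not_isNormal {M : Term} {m : MDist} (h : NonUEval M m) : ¬ IsNormal M :=
  fun hM => hM ⟨m, h.1⟩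

/-- The steps that are not evaluation steps do not lead to normal forms. -/
theorem NonUEval.exists_eq_pure {M : Term} {m : MDist} (h : NonUEval M m) :
    ∃ N, m = MDist.pure N ∧ BetaStep M N ∧ ¬ IsNormal N := by
  rcases h.1 with ⟨N, hN, rfl⟩ | hc
  · rw [betaV_iff] at hN
    refine ⟨N, rfl, hN, ?_⟩
    by_cases hM : IsSNormal M
    · obtain ⟨N', hN'⟩ := hN.reducible_of_not_unbiased
        ((uEval_pure_of_isSNormal hM).not.1 h.2)
      exact fun hn => hn ⟨_, red_pure_iff.2 hN'⟩
    · have hi := hN.weak_or_inner.resolve_left ((uEval_pure_of_not_isSNormal hM).not.1 h.2)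
      obtain ⟨m, hm⟩ := not_not.1 (hi.isSNormal_iff.not.1 hM)
      refine fun hn => hn ⟨m, ?_⟩
      rcases hm with ⟨N', h, rfl⟩ | h
      · exact red_pure_iff.2 (weakBetaV_iff.1 h).beta
      · exact .inr h
  · exact absurd (SRed.uEval (.inr hc)) h.2

/-! ### Lifting to multi-distributions -/

/-- The lifting of a relation to multisets of weighted terms, entry by entry and without the side
conditions on the weights. -/
inductive LiftM (r : Term → MDist → Prop) : Multiset (ℝ × Term) → Multiset (ℝ × Term) → Prop
  | zero : LiftM r 0 0
  | cons {M : Term} {m : MDist} {s t : Multiset (ℝ × Term)} (p : ℝ) :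
      m = MDist.pure M ∨ r M m → LiftM r s t → LiftM r ((p, M) ::ₘ s) (scale p m.entries + t)

theorem scale_one (s : Multiset (ℝ × Term)) : scale 1 s = s := by
  simp [scale]

theorem scale_add (q : ℝ) (s t : Multiset (ℝ × Term)) :
    scale q (s + t) = scale q s + scale q t := Multiset.map_add _ _ _

theorem scale_scale (q p : ℝ) (s : Multiset (ℝ × Term)) :
    scale q (scale p s) = scale (q * p) s := by
  simp [scale, mul_assoc]

theorem scale_pure (p : ℝ) (M : Term) : scale p (MDist.pure M).entries = {(p, M)} := by
  simp [scale, MDist.pure]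

theorem scale_coin (p : ℝ) (M N : Term) :
    scale p (MDist.coin M N).entries = {(p * (1 / 2), M)} + {(p * (1 / 2), N)} := by
  simp [scale, MDist.coin]

theorem LiftM.singleton {r : Term → MDist → Prop} {M : Term} {m : MDist} (p : ℝ)
    (h : m = MDist.pure M ∨ r M m) : LiftM r {(p, M)} (scale p m.entries) := by
  simpa using LiftM.cons p h .zero

theorem LiftM.refl (r : Term → MDist → Prop) (s : Multiset (ℝ × Term)) : LiftM r s s := by
  induction s using Multiset.induction_on with
  | empty => exact .zero
  | cons e s ih => simpa [scale_pure] using LiftM.cons e.1 (.inl (rfl : _ = MDist.pure e.2)) ih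

theorem LiftM.add {r : Term → MDist → Prop} {s t s' t' : Multiset (ℝ × Term)} (h : LiftM r s t)
    (h' : LiftM r s' t') : LiftM r (s + s') (t + t') := by
  induction h with
  | zero => simpa using h'
  | cons p hM _ ih => rw [Multiset.cons_add, add_assoc]; exact .cons p hM ih

theorem LiftM.scale {r : Term → MDist → Prop} {s t : Multiset (ℝ × Term)} (h : LiftM r s t)
    (q : ℝ) : LiftM r (scale q s) (scale q t) := by
  induction h with
  | zero => exact .zero
  | cons p hM _ ih =>
    rw [scale_add, scale_scale, PLam.scale, Multiset.map_cons]
    exact .cons _ hM ih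

theorem LiftM.star_add {r : Term → MDist → Prop} {s t s' t' : Multiset (ℝ × Term)}
    (h : ReflTransGen (LiftM r) s t) (h' : ReflTransGen (LiftM r) s' t') :
    ReflTransGen (LiftM r) (s + s') (t + t') :=
  (h.lift (· + s') fun _ _ h => h.add (.refl r s')).trans
    (h'.lift (t + ·) fun _ _ h => (LiftM.refl r t).add h)

theorem LiftM.star_singleton {r : Term → MDist → Prop} {M N : Term} (p : ℝ)
    (h : ReflTransGen (fun X Y => r X (MDist.pure Y)) M N) :
    ReflTransGen (LiftM r) {(p, M)} {(p, N)} :=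
  h.lift (fun X => ({(p, X)} : Multiset (ℝ × Term))) fun _ Y h => by
    simpa [scale_pure] using LiftM.singleton p (.inr h)

theorem LiftM.sum {r : Term → MDist → Prop} {ι : Type} (I : Finset ι)
    {s t : ι → Multiset (ℝ × Term)} (h : ∀ i ∈ I, LiftM r (s i) (t i)) :
    LiftM r (∑ i ∈ I, s i) (∑ i ∈ I, t i) := by
  classical
  induction I using Finset.induction_on with
  | empty => exact .zero
  | insert i I hi ih =>
    rw [Finset.sum_insert hi, Finset.sum_insert hi]
    exact (h i (Finset.mem_insert_self i I)).add
      (ih fun j hj => h j (Finset.mem_insert_of_mem hj))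

theorem entries_eq_sum {k : ℕ} (p : Fin k → ℝ) (M : Fin k → Term) :
    (Finset.univ : Finset (Fin k)).val.map (fun i => (p i, M i)) =
      ∑ i, scale (p i) (MDist.pure (M i)).entries := by
  simp only [scale_pure, Finset.sum]
  rw [← Multiset.sum_map_singleton (Multiset.map _ _), Multiset.map_map]
  rfl

theorem Lift.liftM {r : Term → MDist → Prop} {a b : MDist} (h : Lift r a b) :
    LiftM r a.entries b.entries := by
  induction h with
  | refl M => exact .refl _ _
  | @step M m h => exact scale_one m.entries ▸ LiftM.singleton 1 (.inr h)
  | sum p M m a b ha hb _ ih =>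
    rw [ha, hb, entries_eq_sum]
    exact .sum _ fun i _ => (ih i).scale (p i)

theorem LiftM.exists_fin {r : Term → MDist → Prop} {s t : Multiset (ℝ × Term)}
    (h : LiftM r s t) : ∃ (k : ℕ) (p : Fin k → ℝ) (M : Fin k → Term) (m : Fin k → MDist),
      s = ∑ i, PLam.scale (p i) (MDist.pure (M i)).entries ∧
      t = ∑ i, PLam.scale (p i) (m i).entries ∧ ∀ i, m i = MDist.pure (M i) ∨ r (M i) (m i) := by
  induction h with
  | zero => exact ⟨0, nofun, nofun, nofun, rfl, rfl, nofun⟩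
  | @cons M m s t q hM _ ih =>
    obtain ⟨k, p, N, n, rfl, rfl, h⟩ := ih
    refine ⟨k + 1, Fin.cons q p, Fin.cons M N, Fin.cons m n, ?_, ?_, ?_⟩
    · simp [Fin.sum_univ_succ, scale_pure]
    · simp [Fin.sum_univ_succ]
    · exact Fin.cases hM h

theorem LiftM.lift {r : Term → MDist → Prop} {a b : MDist} (h : LiftM r a.entries b.entries) :
    Lift r a b := by
  obtain ⟨k, p, M, m, ha, hb, hM⟩ := h.exists_fin
  refine .sum p M m a b (ha.trans (entries_eq_sum p M).symm) hb fun i => ?_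
  rcases hM i with h | h
  · rw [h]; exact .refl _
  · exact .step h

theorem LiftM.weights {r : Term → MDist → Prop} {s t : Multiset (ℝ × Term)} (h : LiftM r s t)
    (hs : ∀ e ∈ s, e.1 ∈ Set.Ioc (0 : ℝ) 1) :
    (∀ e ∈ t, e.1 ∈ Set.Ioc (0 : ℝ) 1) ∧ (t.map Prod.fst).sum ≤ (s.map Prod.fst).sum := by
  induction h with
  | zero => exact ⟨hs, le_rfl⟩
  | @cons M m s t p _ _ ih =>
    obtain ⟨h₁, h₂⟩ := ih fun e he => hs e (Multiset.mem_cons_of_mem he)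
    have hp : p ∈ Set.Ioc (0 : ℝ) 1 := hs (p, M) (Multiset.mem_cons_self _ _)
    refine ⟨fun e he => ?_, ?_⟩
    · rcases Multiset.mem_add.1 he with he | he
      · obtain ⟨e', he', rfl⟩ := Multiset.mem_map.1 he
        have := m.mem_Ioc e' he'
        exact ⟨mul_pos hp.1 this.1, mul_le_one₀ hp.2 this.1.le this.2⟩
      · exact h₁ e he
    · have : ((PLam.scale p m.entries).map Prod.fst).sum = p * (m.entries.map Prod.fst).sum := by
        rw [PLam.scale, Multiset.map_map, ← Multiset.sum_map_mul_left]
        rfl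
      rw [Multiset.map_add, Multiset.sum_add, Multiset.map_cons, Multiset.sum_cons, this]
      exact add_le_add (mul_le_of_le_one_right hp.1.le m.sum_le) h₂

theorem LiftM.star_lift {r : Term → MDist → Prop} {a : MDist} {t : Multiset (ℝ × Term)}
    (h : ReflTransGen (LiftM r) a.entries t) :
    ∃ b : MDist, b.entries = t ∧ ReflTransGen (Lift r) a b := by
  induction h with
  | refl => exact ⟨a, rfl, .refl⟩
  | @tail _ t _ h ih =>
    obtain ⟨b, rfl, hb⟩ := ih
    obtain ⟨h₁, h₂⟩ := h.weights b.mem_Ioc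
    let c : MDist := ⟨t, h₁, h₂.trans b.sum_le⟩
    exact ⟨c, rfl, hb.tail (LiftM.lift (b := c) h)⟩

/-! ### Factorization of multi-distributions -/

/-- Entries of the same weight, the term of the second being a beta reduct of that of the first. -/
def BetaReduct (e e' : ℝ × Term) : Prop := e.1 = e'.1 ∧ ReflTransGen BetaStep e.2 e'.2

theorem Std.choiceStep {T N N₁ N₂ : Term} {n : ℕ} (h : Std false T N n)
    (hN : ChoiceStep N N₁ N₂) : ∃ T₁ T₂, ChoiceStep T T₁ T₂ ∧ ReflTransGen BetaStep T₁ N₁ ∧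
      ReflTransGen BetaStep T₂ N₂ := by
  induction hN generalizing T n with
  | root P Q =>
    cases h with
    | choice hA hB => exact ⟨_, _, .root _ _, hA.beta_star.1, hB.beta_star.1⟩
  | appL _ ih =>
    cases h with
    | app hA hB =>
      obtain ⟨_, _, h, h₁, h₂⟩ := ih hA
      exact ⟨_, _, .appL h,
        (h₁.lift (Term.app · _) fun _ _ => .appL).trans
          (hB.beta_star.1.lift (Term.app _ ·) fun _ _ => .appR),
        (h₂.lift (Term.app · _) fun _ _ => .appL).trans
          (hB.beta_star.1.lift (Term.app _ ·) fun _ _ => .appR)⟩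
  | appR _ ih =>
    cases h with
    | app hA hB =>
      obtain ⟨_, _, h, h₁, h₂⟩ := ih hB
      exact ⟨_, _, .appR h,
        (hA.beta_star.1.lift (Term.app · _) fun _ _ => .appL).trans
          (h₁.lift (Term.app _ ·) fun _ _ => .appR),
        (hA.beta_star.1.lift (Term.app · _) fun _ _ => .appL).trans
          (h₂.lift (Term.app _ ·) fun _ _ => .appR)⟩

/-- Surface steps can be brought forward over beta reductions of the entries: a `⊕` in a weak
position of a beta reduct is already in a weak position once the weak steps of a standard
reduction are done. -/
theorem LiftM.postpone {s t u : Multiset (ℝ × Term)} (h : LiftM Red s t)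
    (hu : Multiset.Rel BetaReduct u s) :
    ∃ v, ReflTransGen (LiftM UEval) u v ∧ Multiset.Rel BetaReduct v t := by
  induction h generalizing u with
  | zero => exact ⟨u, .refl, hu⟩
  | @cons N m s t p hN _ ih =>
    obtain ⟨⟨q, T⟩, u', ⟨he, hT⟩, hu', rfl⟩ := Multiset.rel_cons_right.1 hu
    obtain ⟨v, hv, hv'⟩ := ih hu'
    obtain rfl : q = p := he
    suffices ∃ w, ReflTransGen (LiftM UEval) {(q, T)} w ∧
        Multiset.Rel BetaReduct w (PLam.scale q m.entries) by
      obtain ⟨w, hw, hw'⟩ := this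
      exact ⟨w + v, by simpa using LiftM.star_add hw hv, hw'.add hv'⟩
    have single {p : ℝ} {M N : Term} (h : ReflTransGen BetaStep M N) :
        Multiset.Rel BetaReduct {(p, M)} {(p, N)} :=
      .cons ⟨rfl, h⟩ .zero
    rcases hN with rfl | ⟨N', hN', rfl⟩ | hc
    · exact ⟨_, .refl, scale_pure q N ▸ single hT⟩
    · exact ⟨_, .refl, scale_pure q N' ▸ single (hT.tail (betaV_iff.1 hN'))⟩
    · obtain ⟨N₁, N₂, hN', rfl⟩ := redChoice_iff.1 hc
      obtain ⟨n, hn⟩ := exists_std hT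
      obtain ⟨U, k, -, hU, hk⟩ := hn.decompose
      obtain ⟨U₁, U₂, hc', h₁, h₂⟩ := hk.choiceStep hN'
      refine ⟨PLam.scale q (MDist.coin U₁ U₂).entries, .tail (b := {(q, U)}) ?_ ?_, ?_⟩
      · exact LiftM.star_singleton q (ReflTransGen.mono
          (fun X Y h => SRed.uEval (.inl ⟨Y, weakBetaV_iff.2 h, rfl⟩)) _ _ hU)
      · exact .singleton q (.inr (SRed.uEval (.inr (redChoice_iff.2 ⟨_, _, hc', rfl⟩))))
      · rw [scale_coin, scale_coin]
        exact (single h₁).add (single h₂)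

theorem rel_betaReduct_refl (s : Multiset (ℝ × Term)) : Multiset.Rel BetaReduct s s :=
  Multiset.rel_refl_of_refl_on fun _ _ => ⟨rfl, .refl⟩

theorem LiftM.exists_uEval_star {s t : Multiset (ℝ × Term)} (h : ReflTransGen (LiftM Red) s t) :
    ∃ u, ReflTransGen (LiftM UEval) s u ∧ Multiset.Rel BetaReduct u t := by
  induction h with
  | refl => exact ⟨s, .refl, rel_betaReduct_refl s⟩
  | tail _ h ih =>
    obtain ⟨u, hu, hu'⟩ := ih
    obtain ⟨v, hv, hv'⟩ := h.postpone hu'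
    exact ⟨v, hu.trans hv, hv'⟩

theorem LiftM.factorization_of_rel {s t : Multiset (ℝ × Term)}
    (h : Multiset.Rel BetaReduct s t) :
    ∃ u, ReflTransGen (LiftM UEval) s u ∧ ReflTransGen (LiftM NonUEval) u t := by
  induction h with
  | zero => exact ⟨0, .refl, .refl⟩
  | @cons e e' s t he _ ih =>
    obtain ⟨u, hu, hu'⟩ := ih
    obtain ⟨p, M⟩ := e
    obtain ⟨q, N⟩ := e'
    obtain ⟨hpq, hMN⟩ := he
    obtain rfl : p = q := hpq
    obtain ⟨T, hT, hT'⟩ := uEval_factorization hMN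
    exact ⟨{(p, T)} + u, by simpa using LiftM.star_add (LiftM.star_singleton p hT) hu,
      by simpa using LiftM.star_add (LiftM.star_singleton p hT') hu'⟩

theorem lift_factorization {m n : MDist} (h : ReflTransGen (Lift Red) m n) :
    ∃ t, ReflTransGen (Lift UEval) m t ∧ ReflTransGen (Lift NonUEval) t n := by
  have h' : ReflTransGen (LiftM Red) m.entries n.entries :=
    h.lift MDist.entries fun _ _ => Lift.liftM
  obtain ⟨u, hu, hun⟩ := LiftM.exists_uEval_star h'
  obtain ⟨v, hv, hv'⟩ := LiftM.factorization_of_rel hun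
  obtain ⟨t, rfl, ht⟩ := LiftM.star_lift (hu.trans hv)
  obtain ⟨n', hn', hn⟩ := LiftM.star_lift hv'
  exact ⟨t, ht, MDist.ext hn' ▸ hn⟩

/-! ### Observation -/

theorem mass_add (s t : Multiset (ℝ × Term)) (N : Term) : mass (s + t) N = mass s N + mass t N := by
  simp [mass]

theorem LiftM.mass_eq {s t : Multiset (ℝ × Term)} (h : LiftM NonUEval s t) {N : Term}
    (hN : IsNormal N) : mass s N = mass t N := by
  induction h with
  | zero => rfl
  | @cons M m s t p hM _ ih =>
    rw [← Multiset.singleton_add, mass_add, mass_add, ih]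
    congr 1
    rcases hM with rfl | hM
    · rw [scale_pure]
    · -- Neither side has an entry that is normal.
      obtain ⟨M', rfl, -, hM'⟩ := hM.exists_eq_pure
      have h₁ : M ≠ N := fun h => hM.not_isNormal (h ▸ hN)
      have h₂ : M' ≠ N := fun h => hM' (h ▸ hN)
      simp [scale_pure, mass, h₁, h₂]

theorem obsN_eq_of_lift_nonUEval {m n : MDist} (h : Lift NonUEval m n) : obsN m = obsN n :=
  SubDist.ext (funext fun N => h.liftM.mass_eq N.2)

end PLam

theorem mainTheorem6 :
    (∀ m n : PLam.MDist,
      Relation.ReflTransGen (PLam.Lift PLam.Red) m n →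
        ∃ t : PLam.MDist,
          Relation.ReflTransGen (PLam.Lift PLam.UEval) m t ∧
          Relation.ReflTransGen (PLam.Lift PLam.NonUEval) t n) ∧
    (∀ m n : PLam.MDist,
      PLam.Lift PLam.NonUEval m n → PLam.obsN m = PLam.obsN n) :=
  ⟨fun _ _ => PLam.lift_factorization, fun _ _ => PLam.obsN_eq_of_lift_nonUEval⟩
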